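/- Let $n_1,n_2\ge 1$, $0<\delta<1$, $\mu>0$, $c,\bar c>0$, $a_p,\bar a_q>0$ and $d_{qps},\bar d_{pqr},I_p,J_q\in\mathbb R$, where $p,r$ range over $1,\dots,n_1$ and $q,s$ over $1,\dots,n_2$. Consider the system, for $t>0$, $$D_C^\delta[x_p(t)-c\,x_p(t-\mu)]=-a_px_p(t)+\sum_{q,s}d_{qps}\int_0^\infty k_{qps}(w)g_q(y_q(t-w))\,dw\int_0^\infty h_{qps}(w)g_s(y_s(t-w))\,dw+I_p,$$ $$D_C^\delta[y_q(t)-\bar c\,y_q(t-\mu)]=-\bar a_qy_q(t)+\sum_{p,r}\bar d_{pqr}\int_0^\infty\bar k_{pqr}(w)\bar g_p(x_p(t-w))\,dw\int_0^\infty\bar h_{pqr}(w)\bar g_r(x_r(t-w))\,dw+J_q,$$ with histories $x_p=\phi_p$, $y_q=\varphi_q$ on $(-\infty,0]$, where $D_C^\delta f(t)=\frac1{\Gamma(1-\delta)}\int_0^t(t-w)^{-\delta}f'(w)\,dw$ is the Caputo derivative. A solution consists of continuous functions $x_p,y_q$ on $\mathbb R$ with the given histories such that the integrals over $(0,\infty)$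 converge absolutely, $x_p-c\,x_p(\cdot-\mu)$ and $y_q-\bar c\,y_q(\cdot-\mu)$ are absolutely continuous on every $[0,T]$, and the equations hold for almost every $t>0$. Write $\hat k=\int_0^\infty k(s)\,ds$ for a kernel $k$, and $E_{\delta,\rho}(z)=\sum_{k\ge0}z^k/\Gamma(\delta k+\rho)$, $E_\delta=E_{\delta,1}$. Expressions $E_\delta(-\xi\lambda^\delta)$ with $\lambda<0$ are understood as $E_\delta(0)=1$. Assume: (A1) all kernels $k_{qps},h_{qps},\bar k_{pqr},\bar h_{pqr}$ are piecewise continuous, nonnegative and of finite integral on $[0,\infty)$; (A3) $|g_q(x)-g_q(y)|\le L_q|x-y|$ and $|\bar g_p(x)-\bar g_p(y)|\le M_p|x-y|$ for all real $x,y$ (the functions $g_q,\bar g_p$ may be unbounded). Let $(x_p^*,y_q^*)$ be an equilibrium, i.e. $0=-a_px_p^*+\sum_{q,s}d_{qps}\hat k_{qps}g_q(y_q^*)\hat h_{qps}g_s(y_s^*)+I_p$ and $0=-\bar a_qy_q^*+\sum_{p,r}\bar d_{pqr}\hat{\bar k}_{pqr}\bar g_p(x_p^*)\hat{\bar h}_{pqr}\bar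 g_r(x_r^*)+J_q$. Put $a=\min_pa_p$, $\bar a=\min_q\bar a_q$, $\xi=\min\{a,\bar a\}$, $c^*=\max\{c,\bar c\}$, $A=\max\{\sum_pa_p,\sum_q\bar a_q\}$, $U=A\,\Gamma(1+\delta)\Gamma(1-\delta)/\xi$, $B=1+\xi\Gamma(1-\delta)(2\mu)^\delta$, $F=\frac1{\xi\mu^\delta}+2^\delta\Gamma(1-\delta)$, $B^*=\max\{B,F\}$, $$\theta=\sum_{p,q,s}|d_{qps}|\big(L_q\hat h_{qps}|g_s(y_s^*)|+L_s\hat k_{qps}|g_q(y_q^*)|\big),\qquad\bar\theta=\sum_{p,r,q}|\bar d_{pqr}|\big(M_p\hat{\bar h}_{pqr}|\bar g_r(x_r^*)|+M_r\hat{\bar k}_{pqr}|\bar g_p(x_p^*)|\big),$$ $\pi=\max\{\theta,\bar\theta\}$ (a constant, not the number $3.14\ldots$), and let $K^*(t)$ be the maximum of all the kernels $k_{qps},h_{qps},\bar k_{pqr},\bar h_{pqr}$ at $t$. Assume further: (A5) there is $\Omega>0$ with $\Omega\pi<\frac14$, $c^*<\min\{1,\frac1{2B^*(1+U)}\}$ and,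 for all $t>0$, $$\int_0^t(t-w)^{\delta-1}E_{\delta,\delta}(-\xi(t-w)^\delta)\Big(\int_{-\infty}^wE_\delta(-\xi\lambda^\delta)K^*(w-\lambda)\,d\lambda\Big)dw\le\Omega\,E_\delta(-\xi t^\delta).$$ Then the solutions are locally $\delta$-Mittag-Leffler stable: $\xi>0$, and there are constants $C,\varepsilon>0$ such that, whenever $(x,y)$ is a solution with histories $(\phi,\varphi)$ and $u_0,v_0>0$ satisfy $$\sum_p|\phi_p(w)-x_p^*|\le u_0E_\delta(-a(w+\mu)^\delta),\qquad\sum_q|\varphi_q(w)-y_q^*|\le v_0E_\delta(-\bar a(w+\mu)^\delta)\qquad(w\le0)$$ and $V_0:=\max\{u_0,v_0\}<\varepsilon$, then for all $t>0$ $$u(t):=\sum_p|x_p(t)-x_p^*|\le C\,V_0\,E_\delta(-\xi t^\delta),\qquad v(t):=\sum_q|y_q(t)-y_q^*|\le C\,V_0\,E_\delta(-\xi t^\delta).$$ -/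

import Mathlib

open MeasureTheory Set Filter Topology

noncomputable section

/-- The two-parametric Mittag-Leffler function `E_{δ,ρ}(z) = ∑ z ^ k / Γ(δ k + ρ)` on the real
line. -/
def mittagLeffler₂ (δ ρ z : ℝ) : ℝ :=
  ∑' k : ℕ, z ^ k / Real.Gamma (δ * k + ρ)

/-- The one-parametric Mittag-Leffler function `E_δ = E_{δ,1}`. -/
def mittagLeffler (δ z : ℝ) : ℝ :=
  mittagLeffler₂ δ 1 z

/-- The function `t ↦ E_δ(-ξ t ^ δ)`, continued to `t < 0` by its value `1` at `t = 0`. -/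
def mlDecay (δ ξ t : ℝ) : ℝ :=
  mittagLeffler δ (-ξ * (max t 0) ^ δ)

/-- The Caputo fractional derivative of order `δ ∈ (0, 1)` with base point `0`. -/
def caputoDeriv (δ : ℝ) (f : ℝ → ℝ) (t : ℝ) : ℝ :=
  1 / Real.Gamma (1 - δ) * ∫ w in (0 : ℝ)..t, (t - w) ^ (-δ) * deriv f w

/-- Piecewise continuity on `[0, ∞)`: one-sided limits exist everywhere, and on each bounded
interval there are only finitely many discontinuities. -/
structure PiecewiseContinuous (f : ℝ → ℝ) : Prop where
  finite_disc : ∀ T : ℝ, {t ∈ Icc 0 T | ¬ ContinuousWithinAt f (Ici 0) t}.Finite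
  right_lim : ∀ t : ℝ, 0 ≤ t → ∃ l : ℝ, Tendsto f (𝓝[>] t) (𝓝 l)
  left_lim : ∀ t : ℝ, 0 < t → ∃ l : ℝ, Tendsto f (𝓝[<] t) (𝓝 l)

/-- A delay kernel: piecewise continuous, nonnegative and of finite integral on `[0, ∞)`. -/
structure IsDelayKernel (k : ℝ → ℝ) : Prop where
  piecewiseContinuous : PiecewiseContinuous k
  nonneg : ∀ s : ℝ, 0 ≤ s → 0 ≤ k s
  integrableOn : IntegrableOn k (Ioi 0)

/-- The integral `∫_0^∞ k(s) ds`. -/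
def kernelMass (k : ℝ → ℝ) : ℝ :=
  ∫ s in Ioi (0 : ℝ), k s

/-- The data of a high-order fractional BAM neural network with `n₁ + n₂` neurons, distributed
delays and neutral delay `μ`. The indices of `d`, `k`, `h` are in the order `q p s`, those of
`dbar`, `kbar`, `hbar` in the order `p q r`. -/
structure BAMNetwork (n₁ n₂ : ℕ) where
  /-- order of the fractional derivative -/
  δ : ℝ
  /-- neutral delay -/
  μ : ℝ
  /-- neutral coefficients -/
  c : ℝ
  cbar : ℝ
  /-- dissipation coefficients -/
  a : Fin n₁ → ℝ
  abar : Fin n₂ → ℝ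
  /-- second order parameters -/
  d : Fin n₂ → Fin n₁ → Fin n₂ → ℝ
  dbar : Fin n₁ → Fin n₂ → Fin n₁ → ℝ
  /-- delay kernels -/
  k : Fin n₂ → Fin n₁ → Fin n₂ → ℝ → ℝ
  h : Fin n₂ → Fin n₁ → Fin n₂ → ℝ → ℝ
  kbar : Fin n₁ → Fin n₂ → Fin n₁ → ℝ → ℝ
  hbar : Fin n₁ → Fin n₂ → Fin n₁ → ℝ → ℝ
  /-- activation functions -/
  g : Fin n₂ → ℝ → ℝ
  gbar : Fin n₁ → ℝ → ℝ
  /-- external inputs -/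
  I : Fin n₁ → ℝ
  J : Fin n₂ → ℝ
  δ_pos : 0 < δ
  δ_lt_one : δ < 1
  μ_pos : 0 < μ
  c_pos : 0 < c
  cbar_pos : 0 < cbar
  a_pos : ∀ p, 0 < a p
  abar_pos : ∀ q, 0 < abar q

namespace BAMNetwork

variable {n₁ n₂ : ℕ} (N : BAMNetwork n₁ n₂)

/-- Right-hand side of the equation for `x_p`. -/
def rhsX (x : Fin n₁ → ℝ → ℝ) (y : Fin n₂ → ℝ → ℝ) (p : Fin n₁) (t : ℝ) : ℝ :=
  -N.a p * x p t
    + ∑ q, ∑ s, N.d q p s * (∫ w in Ioi (0 : ℝ), N.k q p s w * N.g q (y q (t - w)))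
        * (∫ w in Ioi (0 : ℝ), N.h q p s w * N.g s (y s (t - w)))
    + N.I p

/-- Right-hand side of the equation for `y_q`. -/
def rhsY (x : Fin n₁ → ℝ → ℝ) (y : Fin n₂ → ℝ → ℝ) (q : Fin n₂) (t : ℝ) : ℝ :=
  -N.abar q * y q t
    + ∑ p, ∑ r, N.dbar p q r * (∫ w in Ioi (0 : ℝ), N.kbar p q r w * N.gbar p (x p (t - w)))
        * (∫ w in Ioi (0 : ℝ), N.hbar p q r w * N.gbar r (x r (t - w)))
    + N.J q

/-- `(x, y)` is a solution of the network with history functions `(φ, ψ)`: the components are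
continuous, the distributed delay integrals exist, the neutral combinations are absolutely
continuous on bounded intervals `[0, T]`, and the Caputo equations hold for almost every
`t > 0`. -/
structure IsSolution (φ : Fin n₁ → ℝ → ℝ) (ψ : Fin n₂ → ℝ → ℝ)
    (x : Fin n₁ → ℝ → ℝ) (y : Fin n₂ → ℝ → ℝ) : Prop where
  continuous_x : ∀ p, Continuous (x p)
  continuous_y : ∀ q, Continuous (y q)
  history_x : ∀ p, ∀ t ≤ 0, x p t = φ p t
  history_y : ∀ q, ∀ t ≤ 0, y q t = ψ q t
  integrable_k : ∀ q p s, ∀ t > 0,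
    IntegrableOn (fun w => N.k q p s w * N.g q (y q (t - w))) (Ioi 0)
  integrable_h : ∀ q p s, ∀ t > 0,
    IntegrableOn (fun w => N.h q p s w * N.g s (y s (t - w))) (Ioi 0)
  integrable_kbar : ∀ p q r, ∀ t > 0,
    IntegrableOn (fun w => N.kbar p q r w * N.gbar p (x p (t - w))) (Ioi 0)
  integrable_hbar : ∀ p q r, ∀ t > 0,
    IntegrableOn (fun w => N.hbar p q r w * N.gbar r (x r (t - w))) (Ioi 0)
  absCont_x : ∀ p, ∀ T > 0,
    AbsolutelyContinuousOnInterval (fun t => x p t - N.c * x p (t - N.μ)) 0 T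
  absCont_y : ∀ q, ∀ T > 0,
    AbsolutelyContinuousOnInterval (fun t => y q t - N.cbar * y q (t - N.μ)) 0 T
  eq_x : ∀ p, ∀ᵐ t : ℝ, 0 < t →
    caputoDeriv N.δ (fun t => x p t - N.c * x p (t - N.μ)) t = N.rhsX x y p t
  eq_y : ∀ q, ∀ᵐ t : ℝ, 0 < t →
    caputoDeriv N.δ (fun t => y q t - N.cbar * y q (t - N.μ)) t = N.rhsY x y q t

/-- `(xs, ys)` is an equilibrium of the network. -/
structure IsEquilibrium (xs : Fin n₁ → ℝ) (ys : Fin n₂ → ℝ) : Prop where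
  eq_x : ∀ p, 0 = -N.a p * xs p
    + ∑ q, ∑ s, N.d q p s * kernelMass (N.k q p s) * N.g q (ys q)
        * kernelMass (N.h q p s) * N.g s (ys s)
    + N.I p
  eq_y : ∀ q, 0 = -N.abar q * ys q
    + ∑ p, ∑ r, N.dbar p q r * kernelMass (N.kbar p q r) * N.gbar p (xs p)
        * kernelMass (N.hbar p q r) * N.gbar r (xs r)
    + N.J q

/-- Assumption on the delay kernels. -/
structure KernelAssumption : Prop where
  kernel_k : ∀ q p s, IsDelayKernel (N.k q p s)
  kernel_h : ∀ q p s, IsDelayKernel (N.h q p s)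
  kernel_kbar : ∀ p q r, IsDelayKernel (N.kbar p q r)
  kernel_hbar : ∀ p q r, IsDelayKernel (N.hbar p q r)

/-- Lipschitz continuity of the (possibly unbounded) activation functions. -/
structure LipschitzActivations (L : Fin n₂ → ℝ) (M : Fin n₁ → ℝ) : Prop where
  lip_g : ∀ q, ∀ x y : ℝ, |N.g q x - N.g q y| ≤ L q * |x - y|
  lip_gbar : ∀ p, ∀ x y : ℝ, |N.gbar p x - N.gbar p y| ≤ M p * |x - y|

/-- `min_p a_p`. -/
def aMin : ℝ := ⨅ p, N.a p

/-- `min_q abar_q`. -/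
def abarMin : ℝ := ⨅ q, N.abar q

/-- The decay parameter `ξ`. -/
def ξ : ℝ := min N.aMin N.abarMin

/-- `c* = max {c, cbar}`. -/
def cStar : ℝ := max N.c N.cbar

/-- `A = max {∑ a_p, ∑ abar_q}`. -/
def bigA : ℝ := max (∑ p, N.a p) (∑ q, N.abar q)

/-- `U = A Γ(1+δ) Γ(1-δ) / ξ`. -/
def bigU : ℝ := N.bigA * (Real.Gamma (1 + N.δ) * Real.Gamma (1 - N.δ) / N.ξ)

/-- `B = 1 + ξ Γ(1-δ) (2μ)^δ`. -/
def bigB : ℝ := 1 + N.ξ * Real.Gamma (1 - N.δ) * (2 * N.μ) ^ N.δ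

/-- `F = 1 / (ξ μ^δ) + 2^δ Γ(1-δ)`. -/
def bigF : ℝ := 1 / (N.ξ * N.μ ^ N.δ) + 2 ^ N.δ * Real.Gamma (1 - N.δ)

/-- `B* = max {B, F}`. -/
def bStar : ℝ := max N.bigB N.bigF

/-- The constant `θ`, with absolute values since `d` and `g(y*)` may have any sign. -/
def theta (L : Fin n₂ → ℝ) (ys : Fin n₂ → ℝ) : ℝ :=
  ∑ p, ∑ q, ∑ s, |N.d q p s| *
    (L q * kernelMass (N.h q p s) * |N.g s (ys s)|
      + L s * kernelMass (N.k q p s) * |N.g q (ys q)|)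

/-- The constant `θbar`. -/
def thetaBar (M : Fin n₁ → ℝ) (xs : Fin n₁ → ℝ) : ℝ :=
  ∑ p, ∑ r, ∑ q, |N.dbar p q r| *
    (M p * kernelMass (N.hbar p q r) * |N.gbar r (xs r)|
      + M r * kernelMass (N.kbar p q r) * |N.gbar p (xs p)|)

/-- The constant `π = max {θ, θbar}` (not the number). -/
def piConst (L : Fin n₂ → ℝ) (M : Fin n₁ → ℝ) (xs : Fin n₁ → ℝ) (ys : Fin n₂ → ℝ) : ℝ :=
  max (N.theta L ys) (N.thetaBar M xs)

/-- The maximum of all the kernels `k_{qps}` and `h_{qps}`. -/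
def kernelK (t : ℝ) : ℝ :=
  max (⨆ i : Fin n₂ × Fin n₁ × Fin n₂, N.k i.1 i.2.1 i.2.2 t)
    (⨆ i : Fin n₂ × Fin n₁ × Fin n₂, N.h i.1 i.2.1 i.2.2 t)

/-- The maximum of all the kernels `kbar_{pqr}` and `hbar_{pqr}`. -/
def kernelH (t : ℝ) : ℝ :=
  max (⨆ i : Fin n₁ × Fin n₂ × Fin n₁, N.kbar i.1 i.2.1 i.2.2 t)
    (⨆ i : Fin n₁ × Fin n₂ × Fin n₁, N.hbar i.1 i.2.1 i.2.2 t)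

/-- `K* = max {K, H}`. -/
def kStar (t : ℝ) : ℝ := max (N.kernelK t) (N.kernelH t)

/-- Smallness assumption, with constant `Ω`, for the equilibrium `(xs, ys)`. -/
structure SmallnessAssumption (L : Fin n₂ → ℝ) (M : Fin n₁ → ℝ) (xs : Fin n₁ → ℝ) (ys : Fin n₂ → ℝ)
    (Ω : ℝ) : Prop where
  Ω_pos : 0 < Ω
  Ω_small : Ω * N.piConst L M xs ys < 1 / 4
  c_small : N.cStar < min 1 (1 / (2 * N.bStar * (1 + N.bigU)))
  kernel_condition : ∀ t > 0,
    (∫ w in (0 : ℝ)..t, (t - w) ^ (N.δ - 1) *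
        mittagLeffler₂ N.δ N.δ (-N.ξ * (t - w) ^ N.δ) *
        ∫ l in Iic w, mlDecay N.δ N.ξ l * N.kStar (w - l))
      ≤ Ω * mittagLeffler N.δ (-N.ξ * t ^ N.δ)

end BAMNetwork

end

/-! Write E(t) = E_δ(-ξ t^δ) and e(t) = t^(δ-1) E_{δ,δ}(-ξ t^δ). The theorem is a continuity
argument with R = 16 V₀. For t ≤ 0 both u and v lie strictly below R E (continued by 1), and at a
first time T of contact the bounds before T would force strict inequality at T
(`neg_of_no_first_zero`, `BAMNetwork.sum_abs_sub_le`, `BAMNetwork.improved_bound_lt`).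

The improvement at T comes from the neutral combination z = (x_p - x_p*) - c (x_p(· - μ) - x_p*),
which solves D^δ z = -a_p z + G. Variation of constants expresses z through the kernels with
parameter a_p, and these are dominated by those with ξ ≤ a_p (`caputo_variation_of_constants`,
`mlKernel_le_of_le`). The forcing G has two parts. The delayed neutral term is at most a multiple of
E by `mlDecay_sub_le`, and convolution of e with E costs only the factor Γ(1+δ)Γ(1-δ)/ξ
(`integral_mlKernel_mul_mlKernel_one_le`). The interaction terms are products, so their deviation
has a part linear in R with coefficient θ and a part of order R²; (A5) controls both after
convolution with e. The quadratic part, due to unbounded activations, is the reason for smallness of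
V₀. Altogether the new constant is at most (1/8 + 1/2 + 1/4 + 1/16) R < R.

The analytic basis is positivity of e (`mlKernel_pos`), obtained by excluding a first zero instead
of using complete monotonicity. With E = 1 - ξ ∫ e and the representation of E as the convolution of
t^(-δ)/Γ(1-δ) with e, it yields monotonicity of E and two-sided bounds of order t^(-δ). -/

/-! ### The Mittag-Leffler series -/

/-- Log-convexity of Γ at x + 1 = δ (x + δ) + (1 - δ)(x + δ + 1), followed by the functional
equation. -/
theorem Real.Gamma_div_Gamma_add_le {δ x : ℝ} (hδ : 0 < δ) (hδ1 : δ < 1) (hx : 0 < x) :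
    Real.Gamma x / Real.Gamma (x + δ) ≤ (x + δ) ^ (1 - δ) / x := by
  have hG := Real.Gamma_pos_of_pos (show 0 < x + δ by linarith)
  have key := Real.Gamma_mul_add_mul_le_rpow_Gamma_mul_rpow_Gamma
    (show 0 < x + δ by linarith) (show 0 < x + δ + 1 by linarith) hδ (sub_pos.2 hδ1) (by ring)
  rw [show δ * (x + δ) + (1 - δ) * (x + δ + 1) = x + 1 by ring, Real.Gamma_add_one hx.ne',
    Real.Gamma_add_one (show x + δ ≠ 0 by linarith), Real.mul_rpow (by linarith) hG.le,
    mul_left_comm, ← Real.rpow_add hG, show δ + (1 - δ) = 1 by ring, Real.rpow_one] at key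
  rw [div_le_div_iff₀ hG hx]
  linarith

theorem tendsto_Gamma_div_Gamma_add {δ : ℝ} (hδ : 0 < δ) (hδ1 : δ < 1) :
    Tendsto (fun x : ℝ => Real.Gamma x / Real.Gamma (x + δ)) atTop (𝓝 0) := by
  have h1 : Tendsto (fun x : ℝ => (2 : ℝ) ^ (1 - δ) * x ^ (-δ)) atTop (𝓝 0) := by
    simpa using (tendsto_rpow_neg_atTop hδ).const_mul ((2 : ℝ) ^ (1 - δ))
  refine tendsto_of_tendsto_of_tendsto_of_le_of_le' tendsto_const_nhds h1 ?_ ?_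
  · filter_upwards [eventually_gt_atTop 0] with x hx
    exact div_nonneg (Real.Gamma_pos_of_pos hx).le (Real.Gamma_pos_of_pos (by linarith)).le
  · filter_upwards [eventually_ge_atTop 1] with x hx
    have hx0 : 0 < x := by linarith
    refine (Real.Gamma_div_Gamma_add_le hδ hδ1 hx0).trans ?_
    rw [div_le_iff₀ hx0, mul_assoc, ← Real.rpow_add_one hx0.ne', neg_add_eq_sub,
      ← Real.mul_rpow (by norm_num) hx0.le]
    exact Real.rpow_le_rpow (by linarith) (by linarith) (by linarith)

section Series

variable {δ ρ : ℝ}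

theorem Gamma_series_pos (hδ : 0 < δ) (hρ : 0 < ρ) (k : ℕ) : 0 < Real.Gamma (δ * k + ρ) :=
  Real.Gamma_pos_of_pos (by positivity)

/-- Ratio test: consecutive coefficients have quotient Γ(x)/Γ(x + δ) with x = δ k + ρ → ∞. -/
theorem mittagLeffler₂_radius (hδ : 0 < δ) (hδ1 : δ < 1) (hρ : 0 < ρ) :
    (FormalMultilinearSeries.ofScalars ℝ
      (fun k : ℕ => (Real.Gamma (δ * k + ρ))⁻¹)).radius = ⊤ := by
  apply FormalMultilinearSeries.ofScalars_radius_eq_top_of_tendsto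
  · exact Eventually.of_forall fun k => inv_ne_zero (Gamma_series_pos hδ hρ k).ne'
  · have h1 : Tendsto (fun k : ℕ => δ * (k : ℝ) + ρ) atTop atTop :=
      tendsto_atTop_add_const_right _ _ (tendsto_natCast_atTop_atTop.const_mul_atTop hδ)
    refine ((tendsto_Gamma_div_Gamma_add hδ hδ1).comp h1).congr fun k => ?_
    have e : δ * ((k.succ : ℕ) : ℝ) + ρ = δ * k + ρ + δ := by push_cast; ring
    have h2 := Gamma_series_pos hδ hρ k
    have h3 : 0 < Real.Gamma (δ * k + ρ + δ) := e ▸ Gamma_series_pos hδ hρ k.succ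
    simp only [Function.comp, e, norm_inv, Real.norm_eq_abs, abs_of_pos h2, abs_of_pos h3]
    field_simp

theorem summable_mittagLeffler₂ (hδ : 0 < δ) (hδ1 : δ < 1) (hρ : 0 < ρ) (z : ℝ) :
    Summable fun k : ℕ => z ^ k / Real.Gamma (δ * k + ρ) := by
  have h := FormalMultilinearSeries.summable (x := z) (FormalMultilinearSeries.ofScalars ℝ
      (fun k : ℕ => (Real.Gamma (δ * k + ρ))⁻¹))
      (by rw [mittagLeffler₂_radius hδ hδ1 hρ]; simp)
  simp only [FormalMultilinearSeries.ofScalars_apply_eq] at h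
  exact h.congr fun k => by rw [smul_eq_mul, div_eq_inv_mul]

theorem differentiable_mittagLeffler₂ (hδ : 0 < δ) (hδ1 : δ < 1) (hρ : 0 < ρ) :
    Differentiable ℝ (mittagLeffler₂ δ ρ) := by
  have hr := mittagLeffler₂_radius hδ hδ1 hρ
  have h := ((FormalMultilinearSeries.ofScalars ℝ
      (fun k : ℕ => (Real.Gamma (δ * k + ρ))⁻¹)).hasFPowerSeriesOnBall
      (by rw [hr]; simp)).differentiableOn
  rw [hr, Metric.eball_top, differentiableOn_univ] at h
  have e : mittagLeffler₂ δ ρ = FormalMultilinearSeries.ofScalarsSum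
      (fun k : ℕ => (Real.Gamma (δ * k + ρ))⁻¹) := by
    rw [FormalMultilinearSeries.ofScalarsSum_eq_tsum]
    funext z
    exact tsum_congr fun k => by rw [smul_eq_mul, div_eq_inv_mul]
  rw [e]
  exact h

theorem mittagLeffler₂_zero (δ ρ : ℝ) : mittagLeffler₂ δ ρ 0 = 1 / Real.Gamma ρ := by
  unfold mittagLeffler₂
  rw [tsum_eq_single 0]
  · simp
  · intro k hk
    simp [hk]

theorem mittagLeffler₂_eq_add (hδ : 0 < δ) (hδ1 : δ < 1) (hρ : 0 < ρ) (z : ℝ) :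
    mittagLeffler₂ δ ρ z = 1 / Real.Gamma ρ + z * mittagLeffler₂ δ (ρ + δ) z := by
  unfold mittagLeffler₂
  rw [(summable_mittagLeffler₂ hδ hδ1 hρ z).tsum_eq_zero_add, ← tsum_mul_left]
  congr 1
  · simp
  · refine tsum_congr fun k => ?_
    rw [pow_succ, show δ * ((k + 1 : ℕ) : ℝ) + ρ = δ * k + (ρ + δ) by push_cast; ring]
    ring

end Series

/-! ### Fractional kernels -/

/-- The kernel `t ^ (α - 1) / Γ(α)` of the Riemann–Liouville integral of order `α`. -/
noncomputable def fracKernel (α t : ℝ) : ℝ := t ^ (α - 1) / Real.Gamma α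

/-- The kernel `t ^ (ρ - 1) E_{δ,ρ}(-ξ t ^ δ)`. -/
noncomputable def mlKernel (δ ξ ρ t : ℝ) : ℝ := t ^ (ρ - 1) * mittagLeffler₂ δ ρ (-ξ * t ^ δ)

theorem fracKernel_nonneg {α t : ℝ} (hα : 0 < α) (ht : 0 ≤ t) : 0 ≤ fracKernel α t :=
  div_nonneg (Real.rpow_nonneg ht _) (Real.Gamma_pos_of_pos hα).le

theorem fracKernel_pos {α t : ℝ} (hα : 0 < α) (ht : 0 < t) : 0 < fracKernel α t :=
  div_pos (Real.rpow_pos_of_pos ht _) (Real.Gamma_pos_of_pos hα)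

theorem fracKernel_one (t : ℝ) : fracKernel 1 t = 1 := by simp [fracKernel]

theorem integral_fracKernel_mul_fracKernel {α β t : ℝ} (hα : 0 < α) (hβ : 0 < β) (ht : 0 < t) :
    ∫ s in (0 : ℝ)..t, fracKernel β (t - s) * fracKernel α s = fracKernel (α + β) t := by
  have hαG := Real.Gamma_pos_of_pos hα
  have hβG := Real.Gamma_pos_of_pos hβ
  have hG := Real.Gamma_pos_of_pos (add_pos hα hβ)
  have h1 : ∫ s in (0 : ℝ)..t, s ^ (α - 1) * (t - s) ^ (β - 1)
      = t ^ (α + β - 1) * (Real.Gamma α * Real.Gamma β / Real.Gamma (α + β)) := by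
    have hs := Complex.betaIntegral_scaled (α : ℂ) (β : ℂ) ht
    have hg := Complex.Gamma_mul_Gamma_eq_betaIntegral (s := (α : ℂ)) (t := (β : ℂ))
      (by simpa using hα) (by simpa using hβ)
    have hG' : Complex.Gamma ((α : ℂ) + β) ≠ 0 := by
      rw [← Complex.ofReal_add, Complex.Gamma_ofReal]
      exact_mod_cast hG.ne'
    have hb : Complex.betaIntegral (α : ℂ) β
        = ((Real.Gamma α * Real.Gamma β / Real.Gamma (α + β) : ℝ) : ℂ) := by
      push_cast
      rw [← Complex.Gamma_ofReal, ← Complex.Gamma_ofReal, ← Complex.Gamma_ofReal,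
        Complex.ofReal_add, hg, mul_div_cancel_left₀ _ hG']
    rw [hb] at hs
    have e : ∫ s in (0 : ℝ)..t, (s : ℂ) ^ ((α : ℂ) - 1) * ((t : ℂ) - s) ^ ((β : ℂ) - 1)
        = ((∫ s in (0 : ℝ)..t, s ^ (α - 1) * (t - s) ^ (β - 1) : ℝ) : ℂ) := by
      rw [← intervalIntegral.integral_ofReal]
      refine intervalIntegral.integral_congr fun s hs => ?_
      rw [uIcc_of_le ht.le] at hs
      simp only [Complex.ofReal_mul]
      rw [Complex.ofReal_cpow hs.1, Complex.ofReal_cpow (sub_nonneg.2 hs.2)]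
      push_cast
      rfl
    rw [e] at hs
    have e2 : (t : ℂ) ^ ((α : ℂ) + β - 1) = ((t ^ (α + β - 1) : ℝ) : ℂ) := by
      rw [Complex.ofReal_cpow ht.le]; push_cast; rfl
    rw [e2] at hs
    exact_mod_cast hs
  have h2 : ∀ s : ℝ, fracKernel β (t - s) * fracKernel α s
      = (Real.Gamma α * Real.Gamma β)⁻¹ * (s ^ (α - 1) * (t - s) ^ (β - 1)) := fun s => by
    unfold fracKernel; field_simp
  simp_rw [h2]
  rw [intervalIntegral.integral_const_mul, h1, fracKernel]
  field_simp

/-- A non-integrable function has integral zero by convention, whereas the Beta integral is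
positive. -/
theorem intervalIntegrable_fracKernel_mul {α β t : ℝ} (hα : 0 < α) (hβ : 0 < β) (ht : 0 < t) :
    IntervalIntegrable (fun s => fracKernel β (t - s) * fracKernel α s) volume 0 t := by
  by_contra h
  have := integral_fracKernel_mul_fracKernel hα hβ ht
  rw [intervalIntegral.integral_undef h] at this
  exact (fracKernel_pos (add_pos hα hβ) ht).ne this

section Kernel

variable {δ ξ ρ β t : ℝ}

theorem mlKernel_term (ht : 0 < t) (k : ℕ) :
    t ^ (ρ - 1) * ((-ξ * t ^ δ) ^ k / Real.Gamma (δ * k + ρ))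
      = (-ξ) ^ k * fracKernel (δ * k + ρ) t := by
  rw [fracKernel, mul_pow, ← Real.rpow_natCast (t ^ δ) k, ← Real.rpow_mul ht.le,
    show δ * k + ρ - 1 = (ρ - 1) + δ * k by ring, Real.rpow_add ht]
  ring

theorem hasSum_mlKernel (hδ : 0 < δ) (hδ1 : δ < 1) (hρ : 0 < ρ) (ht : 0 < t) :
    HasSum (fun k : ℕ => (-ξ) ^ k * fracKernel (δ * k + ρ) t) (mlKernel δ ξ ρ t) := by
  have h := ((summable_mittagLeffler₂ hδ hδ1 hρ (-ξ * t ^ δ)).hasSum).mul_left (t ^ (ρ - 1))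
  simp only [mlKernel_term ht] at h
  exact h

/-- Convolution with a fractional kernel raises the order of a Mittag-Leffler kernel. -/
theorem integral_fracKernel_mul_mlKernel (hδ : 0 < δ) (hδ1 : δ < 1) (hρ : 0 < ρ) (hβ : 0 < β)
    (ht : 0 < t) :
    ∫ s in (0 : ℝ)..t, fracKernel β (t - s) * mlKernel δ ξ ρ s = mlKernel δ ξ (ρ + β) t := by
  rw [intervalIntegral.integral_of_le ht.le]
  have hρk : ∀ k : ℕ, 0 < δ * k + ρ := fun k => by positivity
  set F : ℕ → ℝ → ℝ := fun k s => fracKernel β (t - s) * ((-ξ) ^ k * fracKernel (δ * k + ρ) s)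
  have hFe : ∀ k, F k = fun s => (-ξ) ^ k *
      (fracKernel β (t - s) * fracKernel (δ * k + ρ) s) := fun k => by
    funext s; simp only [F]; ring
  have hint : ∀ k, IntegrableOn (F k) (Ioc 0 t) := fun k => by
    rw [hFe]
    exact ((intervalIntegrable_iff_integrableOn_Ioc_of_le ht.le).1
      (intervalIntegrable_fracKernel_mul (hρk k) hβ ht)).const_mul _
  have hval : ∀ k, ∫ s in Ioc 0 t, F k s = (-ξ) ^ k * fracKernel (δ * k + (ρ + β)) t := fun k => by
    rw [hFe, integral_const_mul, ← intervalIntegral.integral_of_le ht.le,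
      integral_fracKernel_mul_fracKernel (hρk k) hβ ht, add_assoc]
  -- The fractional kernels are nonnegative on the interval, so passing to norms only replaces the
  -- coefficient by its absolute value. Absolute convergence of the limiting series then justifies
  -- termwise integration.
  have hnorm : ∀ k, ∫ s in Ioc 0 t, ‖F k s‖ = ‖(-ξ) ^ k * fracKernel (δ * k + (ρ + β)) t‖ := by
    intro k
    have e : ∀ s ∈ Ioc 0 t, ‖F k s‖ = ‖(-ξ) ^ k‖ *
        (fracKernel β (t - s) * fracKernel (δ * k + ρ) s) := fun s hs => by
      have h1 := fracKernel_nonneg hβ (sub_nonneg.2 hs.2)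
      have h2 := fracKernel_nonneg (hρk k) hs.1.le
      rw [hFe, norm_mul, Real.norm_of_nonneg (mul_nonneg h1 h2)]
    rw [setIntegral_congr_fun measurableSet_Ioc e, integral_const_mul,
      ← intervalIntegral.integral_of_le ht.le,
      integral_fracKernel_mul_fracKernel (hρk k) hβ ht, norm_mul, add_assoc,
      Real.norm_of_nonneg (fracKernel_nonneg (by positivity) ht.le)]
  have hs2 := hasSum_mlKernel (ξ := ξ) hδ hδ1 (add_pos hρ hβ) ht
  have key := hasSum_integral_of_summable_integral_norm hint
    (by simp_rw [hnorm]; exact hs2.summable.norm)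
  simp_rw [hval] at key
  have e : ∀ s ∈ Ioc 0 t, fracKernel β (t - s) * mlKernel δ ξ ρ s = ∑' k, F k s := fun s hs =>
    ((hasSum_mlKernel hδ hδ1 hρ hs.1).mul_left _).tsum_eq.symm
  rw [setIntegral_congr_fun measurableSet_Ioc e]
  exact key.unique hs2

theorem mlKernel_eq_sub (hδ : 0 < δ) (hδ1 : δ < 1) (hρ : 0 < ρ) (ht : 0 < t) :
    mlKernel δ ξ ρ t = fracKernel ρ t - ξ * mlKernel δ ξ (ρ + δ) t := by
  rw [mlKernel, mittagLeffler₂_eq_add hδ hδ1 hρ, mlKernel, fracKernel,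
    show ρ + δ - 1 = (ρ - 1) + δ by ring, Real.rpow_add ht]
  ring

theorem mlKernel_one (t : ℝ) : mlKernel δ ξ 1 t = mittagLeffler δ (-ξ * t ^ δ) := by
  simp [mlKernel, mittagLeffler]

theorem differentiableAt_mlKernel (hδ : 0 < δ) (hδ1 : δ < 1) (hρ : 0 < ρ) (ht : 0 < t) :
    DifferentiableAt ℝ (mlKernel δ ξ ρ) t := by
  have h1 : ∀ p : ℝ, DifferentiableAt ℝ (fun t : ℝ => t ^ p) t := fun p =>
    (Real.hasDerivAt_rpow_const (Or.inl ht.ne')).differentiableAt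
  exact (h1 _).mul (((differentiable_mittagLeffler₂ hδ hδ1 hρ) _).comp t ((h1 δ).const_mul (-ξ)))

theorem continuous_mittagLeffler_rpow (hδ : 0 < δ) (hδ1 : δ < 1) (hρ : 0 < ρ) :
    Continuous fun t : ℝ => mittagLeffler₂ δ ρ (-ξ * t ^ δ) :=
  (differentiable_mittagLeffler₂ hδ hδ1 hρ).continuous.comp
    (continuous_const.mul (Real.continuous_rpow_const hδ.le))

theorem continuous_mlKernel_one (hδ : 0 < δ) (hδ1 : δ < 1) : Continuous (mlKernel δ ξ 1) := by
  refine (continuous_mittagLeffler_rpow (ξ := ξ) hδ hδ1 one_pos).congr fun t => ?_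
  simp [mlKernel]

theorem intervalIntegrable_mlKernel (hδ : 0 < δ) (hδ1 : δ < 1) (hρ : 0 < ρ) (a b : ℝ) :
    IntervalIntegrable (mlKernel δ ξ ρ) volume a b :=
  (intervalIntegral.intervalIntegrable_rpow' (by linarith)).mul_continuousOn
    (continuous_mittagLeffler_rpow hδ hδ1 hρ).continuousOn

theorem intervalIntegrable_fracKernel_mul_mlKernel (hδ : 0 < δ) (hδ1 : δ < 1) (hρ : 0 < ρ)
    (hβ : 0 < β) (ht : 0 < t) :
    IntervalIntegrable (fun s => fracKernel β (t - s) * mlKernel δ ξ ρ s) volume 0 t := by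
  have h := ((intervalIntegrable_fracKernel_mul hρ hβ ht).mul_const (Real.Gamma ρ)).mul_continuousOn
    (continuous_mittagLeffler_rpow (ξ := ξ) hδ hδ1 hρ).continuousOn
  refine h.congr fun s _ => ?_
  have := (Real.Gamma_pos_of_pos hρ).ne'
  simp only [fracKernel, mlKernel]
  field_simp

end Kernel

/-! ### Positivity and bounds for the Mittag-Leffler kernels -/

/-- Tangent line of the convex function r ↦ r^(-δ) at y. It quantifies how much the Caputo kernel
decreases under a time shift. -/
theorem rpow_neg_sub_rpow_neg_ge {δ x y : ℝ} (hδ : 0 < δ) (hx : 0 < x) (hxy : x ≤ y) :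
    δ * (y - x) * y ^ (-δ - 1) ≤ x ^ (-δ) - y ^ (-δ) := by
  have hy : 0 < y := hx.trans_le hxy
  have hyδ : 0 < y ^ (-δ) := Real.rpow_pos_of_pos hy _
  have h1 : 1 + δ * (1 - x / y) ≤ (x / y) ^ (-δ) := by
    rw [Real.rpow_def_of_pos (div_pos hx hy)]
    have h2 := Real.add_one_le_exp (Real.log (x / y) * -δ)
    have h3 := Real.log_le_sub_one_of_pos (div_pos hx hy)
    nlinarith
  rw [Real.div_rpow hx.le hy.le, le_div_iff₀ hyδ] at h1
  rw [Real.rpow_sub_one hy.ne']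
  have e : δ * (y - x) * (y ^ (-δ) / y) = δ * (1 - x / y) * y ^ (-δ) := by field_simp
  rw [e]
  linarith

section Kernel

variable {δ ξ t : ℝ}

/-- The index shift `mlKernel_eq_sub` at ρ = 1, with the remainder recognised as the integral of e.
Differentiating gives E' = -ξ e. -/
theorem mlKernel_one_eq_integral (hδ : 0 < δ) (hδ1 : δ < 1) (ht : 0 ≤ t) :
    mlKernel δ ξ 1 t = 1 - ξ * ∫ s in (0 : ℝ)..t, mlKernel δ ξ δ s := by
  rcases ht.eq_or_lt with rfl | ht
  · simp [mlKernel, mittagLeffler₂_zero, Real.zero_rpow hδ.ne']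
  have h := integral_fracKernel_mul_mlKernel (ξ := ξ) hδ hδ1 hδ one_pos ht
  simp only [fracKernel_one, one_mul] at h
  rw [mlKernel_eq_sub hδ hδ1 one_pos ht, fracKernel_one, h, add_comm]

theorem integral_fracKernel_one_sub_mul_mlKernel (hδ : 0 < δ) (hδ1 : δ < 1) (ht : 0 < t) :
    ∫ s in (0 : ℝ)..t, fracKernel (1 - δ) (t - s) * mlKernel δ ξ δ s = mlKernel δ ξ 1 t := by
  rw [integral_fracKernel_mul_mlKernel hδ hδ1 hδ (sub_pos.2 hδ1) ht, add_sub_cancel]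

theorem hasDerivAt_mlKernel_one (hδ : 0 < δ) (hδ1 : δ < 1) (ht : 0 < t) :
    HasDerivAt (mlKernel δ ξ 1) (-ξ * mlKernel δ ξ δ t) t := by
  have hd : ∀ {s}, 0 < s → DifferentiableAt ℝ (mlKernel δ ξ δ) s := fun hs =>
    differentiableAt_mlKernel hδ hδ1 hδ hs
  have h := intervalIntegral.integral_hasDerivAt_right
    (intervalIntegrable_mlKernel (ξ := ξ) hδ hδ1 hδ 0 t)
    (ContinuousOn.stronglyMeasurableAtFilter (s := Ioi (0 : ℝ)) isOpen_Ioi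
      (fun s hs => (hd hs).continuousAt.continuousWithinAt) t ht) (hd ht).continuousAt
  have h2 := (h.const_mul ξ).const_sub 1
  rw [← neg_mul] at h2
  refine h2.congr_of_eventuallyEq ?_
  filter_upwards [lt_mem_nhds ht] with s hs
  exact mlKernel_one_eq_integral hδ hδ1 hs.le

/-- The kernel `t ^ (δ - 1) E_{δ,δ}(-ξ t ^ δ)` has no first zero. -/
theorem mlKernel_no_first_zero (hδ : 0 < δ) (hδ1 : δ < 1) (ht : 0 < t)
    (hzero : mlKernel δ ξ δ t = 0) (hpos : ∀ s ∈ Ioo 0 t, 0 < mlKernel δ ξ δ s) : False := by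
  set e := mlKernel δ ξ δ with he
  have hδ' : 0 < 1 - δ := sub_pos.2 hδ1
  have hG : 0 < Real.Gamma (1 - δ) := Real.Gamma_pos_of_pos hδ'
  -- At the zero E'(t) = -ξ e(t) = 0. On the other hand E is the convolution of a strictly
  -- decreasing kernel with e, which is positive before t, and this makes E drop at a linear rate
  -- just before t.
  have hE := hasDerivAt_mlKernel_one (ξ := ξ) hδ hδ1 ht
  rw [← he, hzero, mul_zero] at hE
  -- Differentiability at the zero gives e(s) ≤ C (t - s) nearby, which outweighs the singularity (t
  -- - s)^(-δ).
  obtain ⟨C, hC⟩ := (differentiableAt_mlKernel (ξ := ξ) hδ hδ1 hδ ht).isBigO_sub.bound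
  rw [← he] at hC
  have he_int : ∀ a b, IntervalIntegrable e volume a b := fun a b =>
    intervalIntegrable_mlKernel hδ hδ1 hδ a b
  have he_nonneg : ∀ s ∈ Ioo 0 t, 0 ≤ e s := fun s hs => (hpos s hs).le
  set m := ∫ s in (0 : ℝ)..(t / 2), e s with hm
  have hm_pos : 0 < m := intervalIntegral.intervalIntegral_pos_of_pos_on (he_int _ _)
    (fun s hs => hpos s ⟨hs.1, by linarith [hs.2]⟩) (by linarith)
  set c := δ * t ^ (-δ - 1) * m / Real.Gamma (1 - δ) with hc
  have hc_pos : 0 < c := by positivity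
  -- the increment of the Mittag-Leffler function to the left of the zero
  have key : ∀ᶠ h in 𝓝[>] (0 : ℝ),
      c * h - C / Real.Gamma (1 - δ) * h ^ (1 - δ) * h
        ≤ mlKernel δ ξ 1 (t - h) - mlKernel δ ξ 1 t := by
    obtain ⟨η, hη, hball⟩ := Metric.eventually_nhds_iff.1 hC
    filter_upwards [Ioo_mem_nhdsGT (show 0 < min η (t / 2) by positivity)] with h hh
    obtain ⟨hh0, hhη, hht⟩ : 0 < h ∧ h < η ∧ h < t / 2 :=
      ⟨hh.1, hh.2.trans_le (min_le_left _ _), hh.2.trans_le (min_le_right _ _)⟩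
    have hth : 0 < t - h := by linarith
    rw [← integral_fracKernel_one_sub_mul_mlKernel hδ hδ1 ht,
      ← integral_fracKernel_one_sub_mul_mlKernel hδ hδ1 hth, ← he]
    have hI1 := intervalIntegrable_fracKernel_mul_mlKernel (ξ := ξ) hδ hδ1 hδ hδ' ht
    have hI2 := intervalIntegrable_fracKernel_mul_mlKernel (ξ := ξ) hδ hδ1 hδ hδ' hth
    rw [← he] at hI1 hI2
    have hmem : t - h ∈ uIcc 0 t := by rw [uIcc_of_le ht.le]; constructor <;> linarith
    have hI1a := hI1.mono_set (uIcc_subset_uIcc_left hmem)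
    have hI1b := hI1.mono_set (uIcc_subset_uIcc_right hmem)
    rw [← intervalIntegral.integral_add_adjacent_intervals hI1a hI1b, ← sub_sub,
      ← intervalIntegral.integral_sub hI2 hI1a]
    -- contribution of `[t - h, t]`
    have hb : ∫ s in (t - h)..t, fracKernel (1 - δ) (t - s) * e s
        ≤ C / Real.Gamma (1 - δ) * h ^ (1 - δ) * h := by
      have : ∫ s in (t - h)..t, fracKernel (1 - δ) (t - s) * e s
          ≤ ∫ s in (t - h)..t, C / Real.Gamma (1 - δ) * h ^ (1 - δ) := by
        refine intervalIntegral.integral_mono_on_of_le_Ioo (by linarith) hI1b (by simp)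
          fun s hs => ?_
        have hts : 0 < t - s := by linarith [hs.2]
        have h1 := hball (y := s) (by
          rw [Real.dist_eq, abs_sub_lt_iff]; constructor <;> linarith [hs.1, hs.2])
        rw [hzero, sub_zero, Real.norm_eq_abs, Real.norm_eq_abs, abs_sub_comm s t,
          abs_of_pos hts] at h1
        have h2 := (le_abs_self _).trans h1
        have hCn : 0 ≤ C := by
          have := (abs_nonneg _).trans h1
          exact nonneg_of_mul_nonneg_left this hts
        calc fracKernel (1 - δ) (t - s) * e s
            ≤ fracKernel (1 - δ) (t - s) * (C * (t - s)) :=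
              mul_le_mul_of_nonneg_left h2 (fracKernel_nonneg hδ' hts.le)
          _ = C / Real.Gamma (1 - δ) * (t - s) ^ (1 - δ) := by
              rw [fracKernel, Real.rpow_sub_one hts.ne']; field_simp
          _ ≤ C / Real.Gamma (1 - δ) * h ^ (1 - δ) := by
              refine mul_le_mul_of_nonneg_left ?_ (div_nonneg hCn hG.le)
              exact Real.rpow_le_rpow hts.le (by linarith [hs.1]) hδ'.le
      refine this.trans_eq ?_
      rw [intervalIntegral.integral_const, smul_eq_mul]
      ring
    -- contribution of `[0, t - h]`
    have hpt : ∀ s ∈ Ioo 0 (t - h), δ * h * t ^ (-δ - 1) / Real.Gamma (1 - δ) * e s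
        ≤ fracKernel (1 - δ) (t - h - s) * e s - fracKernel (1 - δ) (t - s) * e s := by
      intro s hs
      have h1 := rpow_neg_sub_rpow_neg_ge hδ (show 0 < t - h - s by linarith [hs.2])
        (show t - h - s ≤ t - s by linarith)
      rw [show t - s - (t - h - s) = h by ring] at h1
      have h2 : t ^ (-δ - 1) ≤ (t - s) ^ (-δ - 1) :=
        Real.rpow_le_rpow_of_nonpos (by linarith [hs.2]) (by linarith [hs.1]) (by linarith)
      have h3 : δ * h * t ^ (-δ - 1) ≤ (t - h - s) ^ (-δ) - (t - s) ^ (-δ) :=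
        (mul_le_mul_of_nonneg_left h2 (by positivity)).trans h1
      rw [← sub_mul]
      refine mul_le_mul_of_nonneg_right ?_ (he_nonneg s ⟨hs.1, by linarith [hs.2]⟩)
      rw [fracKernel, fracKernel, ← sub_div, show 1 - δ - 1 = -δ by ring]
      gcongr
    have hmem2 : t / 2 ∈ uIcc 0 (t - h) := by
      rw [uIcc_of_le hth.le]; constructor <;> linarith
    have ha : c * h ≤ ∫ s in (0 : ℝ)..(t - h),
        (fracKernel (1 - δ) (t - h - s) * e s - fracKernel (1 - δ) (t - s) * e s) := by
      have hI := hI2.sub hI1a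
      have hIa := hI.mono_set (uIcc_subset_uIcc_left hmem2)
      have hIb := hI.mono_set (uIcc_subset_uIcc_right hmem2)
      have e1 : c * h = ∫ s in (0 : ℝ)..(t / 2),
          δ * h * t ^ (-δ - 1) / Real.Gamma (1 - δ) * e s := by
        rw [intervalIntegral.integral_const_mul, ← hm, hc]; ring
      have h1 : ∫ s in (0 : ℝ)..(t / 2), δ * h * t ^ (-δ - 1) / Real.Gamma (1 - δ) * e s
          ≤ ∫ s in (0 : ℝ)..(t / 2),
            (fracKernel (1 - δ) (t - h - s) * e s - fracKernel (1 - δ) (t - s) * e s) :=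
        intervalIntegral.integral_mono_on_of_le_Ioo (by linarith) ((he_int _ _).const_mul _) hIa
          fun s hs => hpt s ⟨hs.1, by linarith [hs.2]⟩
      have h2 : 0 ≤ ∫ s in (t / 2)..(t - h),
            (fracKernel (1 - δ) (t - h - s) * e s - fracKernel (1 - δ) (t - s) * e s) := by
        have : ∫ s in (t / 2)..(t - h), (0 : ℝ) ≤ ∫ s in (t / 2)..(t - h),
            (fracKernel (1 - δ) (t - h - s) * e s - fracKernel (1 - δ) (t - s) * e s) := by
          refine intervalIntegral.integral_mono_on_of_le_Ioo (by linarith) (by simp) hIb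
            fun s hs => ?_
          have hs' : s ∈ Ioo 0 (t - h) := ⟨by linarith [hs.1], hs.2⟩
          refine le_trans ?_ (hpt s hs')
          have := he_nonneg s ⟨hs'.1, by linarith [hs.2]⟩
          positivity
        simpa using this
      rw [← intervalIntegral.integral_add_adjacent_intervals hIa hIb, e1]
      linarith
    linarith
  -- The vanishing derivative makes the increment o(h). The factor c/4, here and in `hpow`, leaves
  -- room in c h ≤ c h/4 + c h/4 for a contradiction.
  have hsmall : ∀ᶠ h in 𝓝[>] (0 : ℝ),
      mlKernel δ ξ 1 (t - h) - mlKernel δ ξ 1 t ≤ c / 4 * h := by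
    have h1 := (hasDerivAt_iff_isLittleO.1 hE).bound (show 0 < c / 4 by positivity)
    have h2 : Tendsto (fun h : ℝ => t - h) (𝓝[>] 0) (𝓝 t) := by
      have : Tendsto (fun h : ℝ => t - h) (𝓝 0) (𝓝 (t - 0)) :=
        (continuous_const.sub continuous_id).tendsto _
      rw [sub_zero] at this
      exact this.mono_left nhdsWithin_le_nhds
    filter_upwards [h2.eventually h1, self_mem_nhdsWithin] with h hh hpos
    simp only [smul_zero, sub_zero, Real.norm_eq_abs, sub_sub_cancel_left, abs_neg] at hh
    rw [abs_of_pos (show (0 : ℝ) < h from hpos)] at hh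
    exact (le_abs_self _).trans hh
  have hpow : ∀ᶠ h in 𝓝[>] (0 : ℝ), C / Real.Gamma (1 - δ) * h ^ (1 - δ) < c / 4 := by
    have h1 : Tendsto (fun h : ℝ => C / Real.Gamma (1 - δ) * h ^ (1 - δ)) (𝓝 0)
        (𝓝 (C / Real.Gamma (1 - δ) * 0 ^ (1 - δ))) :=
      ((Real.continuous_rpow_const hδ'.le).const_mul _).tendsto _
    rw [Real.zero_rpow hδ'.ne', mul_zero] at h1
    exact (h1.mono_left nhdsWithin_le_nhds).eventually (gt_mem_nhds (by positivity))
  obtain ⟨h, h1, h2, h3, h4⟩ := (key.and (hsmall.and (hpow.and self_mem_nhdsWithin))).exists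
  have hh : (0 : ℝ) < h := h4
  nlinarith [mul_lt_mul_of_pos_right h3 hh]

/-- A nonpositive value would produce a first zero by compactness. The sign of ξ plays no role. -/
theorem mlKernel_pos (hδ : 0 < δ) (hδ1 : δ < 1) (ht : 0 < t) : 0 < mlKernel δ ξ δ t := by
  have hcont := continuous_mittagLeffler_rpow (ξ := ξ) hδ hδ1 hδ
  -- Splitting off the singular power leaves a factor continuous at 0 with value 1/Γ(δ) > 0, so the
  -- least zero is positive.
  set m := fun t : ℝ => mittagLeffler₂ δ δ (-ξ * t ^ δ) with hm
  have hme : ∀ s, mlKernel δ ξ δ s = s ^ (δ - 1) * m s := fun s => rfl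
  by_contra hneg
  have hmt : m t ≤ 0 := by
    by_contra hcon
    exact hneg (mul_pos (Real.rpow_pos_of_pos ht _) (not_le.1 hcon))
  have hm0 : 0 < m 0 := by
    simp only [hm, Real.zero_rpow hδ.ne', mul_zero, mittagLeffler₂_zero]
    exact one_div_pos.2 (Real.Gamma_pos_of_pos hδ)
  obtain ⟨t₀, ⟨ht₀, hmt₀⟩, hleast⟩ :=
    (isCompact_Icc.inter_right (isClosed_Iic.preimage hcont)).exists_isLeast
      (s := Icc 0 t ∩ m ⁻¹' Iic 0) ⟨t, ⟨ht.le, le_rfl⟩, hmt⟩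
  have ht₀pos : 0 < t₀ := ht₀.1.lt_of_ne fun h => by
    rw [← h] at hmt₀; exact absurd hm0 (not_lt.2 hmt₀)
  have hpos : ∀ s ∈ Ioo 0 t₀, 0 < m s := fun s hs => by
    by_contra hcon
    exact absurd (hleast ⟨⟨hs.1.le, hs.2.le.trans ht₀.2⟩, not_lt.1 hcon⟩) (not_le.2 hs.2)
  have hzero : m t₀ = 0 := by
    refine le_antisymm hmt₀ (ge_of_tendsto
      ((hcont.tendsto t₀).mono_left (nhdsWithin_le_nhds (s := Iio t₀))) ?_)
    filter_upwards [Ioo_mem_nhdsLT ht₀pos] with s hs using (hpos s hs).le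
  refine mlKernel_no_first_zero (ξ := ξ) hδ hδ1 ht₀pos (by rw [hme, hzero, mul_zero]) fun s hs => ?_
  rw [hme]
  exact mul_pos (Real.rpow_pos_of_pos hs.1 _) (hpos s hs)

theorem integral_mlKernel_nonneg (hδ : 0 < δ) (hδ1 : δ < 1) {a b : ℝ} (ha : 0 ≤ a) (hab : a ≤ b) :
    0 ≤ ∫ s in a..b, mlKernel δ ξ δ s := by
  have : ∫ s in a..b, (0 : ℝ) ≤ ∫ s in a..b, mlKernel δ ξ δ s :=
    intervalIntegral.integral_mono_on_of_le_Ioo hab (by simp)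
      (intervalIntegrable_mlKernel hδ hδ1 hδ a b)
      fun s hs => (mlKernel_pos hδ hδ1 (ha.trans_lt hs.1)).le
  simpa using this

theorem mlKernel_one_antitoneOn (hδ : 0 < δ) (hδ1 : δ < 1) (hξ : 0 < ξ) :
    AntitoneOn (mlKernel δ ξ 1) (Ici 0) := by
  intro s hs t ht hst
  rw [mlKernel_one_eq_integral hδ hδ1 hs, mlKernel_one_eq_integral hδ hδ1 ht,
    ← intervalIntegral.integral_add_adjacent_intervals
      (intervalIntegrable_mlKernel (ξ := ξ) hδ hδ1 hδ 0 s)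
      (intervalIntegrable_mlKernel hδ hδ1 hδ s t)]
  nlinarith [mul_nonneg hξ.le (integral_mlKernel_nonneg (ξ := ξ) hδ hδ1 hs hst)]

theorem mlKernel_one_zero (hδ : 0 < δ) (hδ1 : δ < 1) : mlKernel δ ξ 1 0 = 1 := by
  simpa using mlKernel_one_eq_integral (ξ := ξ) hδ hδ1 le_rfl

theorem mlKernel_one_le_one (hδ : 0 < δ) (hδ1 : δ < 1) (hξ : 0 < ξ) (ht : 0 ≤ t) :
    mlKernel δ ξ 1 t ≤ 1 :=
  (mlKernel_one_antitoneOn hδ hδ1 hξ (self_mem_Ici) ht ht).trans_eq (mlKernel_one_zero hδ hδ1)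

/-- In the convolution formula for E the kernel is at least t^(-δ)/Γ(1-δ), and ξ ∫ e = 1 - E;
solving for E gives the bound. -/
theorem one_le_mlKernel_one_mul (hδ : 0 < δ) (hδ1 : δ < 1) (hξ : 0 < ξ) (ht : 0 ≤ t) :
    1 ≤ mlKernel δ ξ 1 t * (1 + ξ * Real.Gamma (1 - δ) * t ^ δ) := by
  rcases ht.eq_or_lt with rfl | ht
  · simp [mlKernel_one_zero hδ hδ1, Real.zero_rpow hδ.ne']
  have hδ' : 0 < 1 - δ := sub_pos.2 hδ1
  have hG : 0 < Real.Gamma (1 - δ) := Real.Gamma_pos_of_pos hδ'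
  have h1 : ∫ s in (0 : ℝ)..t, t ^ (-δ) / Real.Gamma (1 - δ) * mlKernel δ ξ δ s
      ≤ ∫ s in (0 : ℝ)..t, fracKernel (1 - δ) (t - s) * mlKernel δ ξ δ s := by
    refine intervalIntegral.integral_mono_on_of_le_Ioo ht.le
      ((intervalIntegrable_mlKernel hδ hδ1 hδ 0 t).const_mul _)
      (intervalIntegrable_fracKernel_mul_mlKernel hδ hδ1 hδ hδ' ht) fun s hs => ?_
    refine mul_le_mul_of_nonneg_right ?_ (mlKernel_pos hδ hδ1 hs.1).le
    rw [fracKernel, show 1 - δ - 1 = -δ by ring]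
    exact div_le_div_of_nonneg_right (Real.rpow_le_rpow_of_nonpos (sub_pos.2 hs.2)
      (by linarith [hs.1]) (by linarith)) hG.le
  rw [integral_fracKernel_one_sub_mul_mlKernel hδ hδ1 ht, intervalIntegral.integral_const_mul] at h1
  have h2 := mlKernel_one_eq_integral (ξ := ξ) hδ hδ1 ht.le
  set I := ∫ s in (0 : ℝ)..t, mlKernel δ ξ δ s
  have htδ : 0 < t ^ δ := Real.rpow_pos_of_pos ht _
  rw [Real.rpow_neg ht.le, inv_div_left, inv_mul_le_iff₀ (by positivity)] at h1
  nlinarith [mul_le_mul_of_nonneg_left h1 hξ.le]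

theorem mlKernel_one_pos (hδ : 0 < δ) (hδ1 : δ < 1) (hξ : 0 < ξ) (ht : 0 ≤ t) :
    0 < mlKernel δ ξ 1 t := by
  have h := one_le_mlKernel_one_mul hδ hδ1 hξ ht
  have hG : 0 < Real.Gamma (1 - δ) := Real.Gamma_pos_of_pos (sub_pos.2 hδ1)
  have h2 := Real.rpow_nonneg ht δ
  exact pos_of_mul_pos_left (one_pos.trans_le h) (by positivity)

/-- Since E decreases, its fractional integral of order δ at t is at least E(t) t^δ/Γ(1+δ). But ξ
times that integral is 1 - E(t) < 1. -/
theorem mlKernel_one_le_inv (hδ : 0 < δ) (hδ1 : δ < 1) (hξ : 0 < ξ) (ht : 0 < t) :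
    mlKernel δ ξ 1 t ≤ Real.Gamma (1 + δ) / ξ * t ^ (-δ) := by
  have hG : 0 < Real.Gamma (1 + δ) := Real.Gamma_pos_of_pos (by linarith)
  have h1 : ∫ s in (0 : ℝ)..t, fracKernel δ (t - s) * fracKernel 1 s * mlKernel δ ξ 1 t
      ≤ ∫ s in (0 : ℝ)..t, fracKernel δ (t - s) * mlKernel δ ξ 1 s := by
    refine intervalIntegral.integral_mono_on_of_le_Ioo ht.le
      ((intervalIntegrable_fracKernel_mul one_pos hδ ht).mul_const _)
      (intervalIntegrable_fracKernel_mul_mlKernel hδ hδ1 one_pos hδ ht) fun s hs => ?_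
    rw [fracKernel_one, mul_one]
    exact mul_le_mul_of_nonneg_left
      (mlKernel_one_antitoneOn hδ hδ1 hξ hs.1.le ht.le hs.2.le)
      (fracKernel_nonneg hδ (by linarith [hs.2]))
  rw [intervalIntegral.integral_mul_const, integral_fracKernel_mul_fracKernel one_pos hδ ht,
    integral_fracKernel_mul_mlKernel hδ hδ1 one_pos hδ ht] at h1
  have h2 := mlKernel_eq_sub (ξ := ξ) hδ hδ1 one_pos ht
  rw [fracKernel_one] at h2
  have hpos := mlKernel_one_pos hδ hδ1 hξ ht.le
  rw [fracKernel, add_sub_cancel_left] at h1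
  have htδ : 0 < t ^ δ := Real.rpow_pos_of_pos ht _
  rw [Real.rpow_neg ht.le, ← div_eq_mul_inv, div_div, le_div_iff₀ (by positivity)]
  have h3 := mul_le_mul_of_nonneg_left h1 hξ.le
  have h4 : ξ * (t ^ δ / Real.Gamma (1 + δ) * mlKernel δ ξ 1 t) ≤ 1 := by linarith
  rw [div_mul_eq_mul_div, mul_div_assoc', div_le_one hG] at h4
  linarith

/-- Convolution of the resolvent kernel with the Mittag-Leffler function. -/
theorem integral_mlKernel_mul_mlKernel_one_le (hδ : 0 < δ) (hδ1 : δ < 1) (hξ : 0 < ξ) (ht : 0 < t) :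
    ∫ s in (0 : ℝ)..t, mlKernel δ ξ δ (t - s) * mlKernel δ ξ 1 s
      ≤ Real.Gamma (1 + δ) * Real.Gamma (1 - δ) / ξ * mlKernel δ ξ 1 t := by
  have hδ' : 0 < 1 - δ := sub_pos.2 hδ1
  have hG : 0 < Real.Gamma (1 - δ) := Real.Gamma_pos_of_pos hδ'
  have e1 := intervalIntegral.integral_comp_sub_left (a := 0) (b := t)
    (fun s => mlKernel δ ξ 1 (t - s) * mlKernel δ ξ δ s) t
  simp only [sub_sub_cancel, sub_self, sub_zero] at e1
  simp_rw [mul_comm (mlKernel δ ξ δ _)]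
  rw [e1, ← integral_fracKernel_one_sub_mul_mlKernel hδ hδ1 ht,
    ← intervalIntegral.integral_const_mul]
  refine intervalIntegral.integral_mono_on_of_le_Ioo ht.le ?_
    ((intervalIntegrable_fracKernel_mul_mlKernel hδ hδ1 hδ hδ' ht).const_mul _) fun s hs => ?_
  · exact (intervalIntegrable_mlKernel hδ hδ1 hδ 0 t).continuousOn_mul
      ((continuous_mlKernel_one hδ hδ1).comp (continuous_const.sub continuous_id)).continuousOn
  · rw [← mul_assoc]
    refine mul_le_mul_of_nonneg_right ?_ (mlKernel_pos hδ hδ1 hs.1).le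
    -- The bound on E(t - s) is a multiple of the kernel of order 1 - δ, whose convolution with e is
    -- E again.
    refine (mlKernel_one_le_inv hδ hδ1 hξ (show 0 < t - s by linarith [hs.2])).trans_eq ?_
    rw [fracKernel, show 1 - δ - 1 = -δ by ring]
    field_simp

end Kernel

/-! ### The Mittag-Leffler decay function -/

section Decay

variable {δ ξ : ℝ}

theorem mlDecay_eq (t : ℝ) : mlDecay δ ξ t = mlKernel δ ξ 1 (max t 0) := by
  rw [mlKernel_one, mlDecay]

theorem mlDecay_of_nonneg {t : ℝ} (ht : 0 ≤ t) : mlDecay δ ξ t = mlKernel δ ξ 1 t := by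
  rw [mlDecay_eq, max_eq_left ht]

theorem mlDecay_of_nonpos (hδ : 0 < δ) (hδ1 : δ < 1) {t : ℝ} (ht : t ≤ 0) :
    mlDecay δ ξ t = 1 := by
  rw [mlDecay_eq, max_eq_right ht, mlKernel_one_zero hδ hδ1]

theorem mlDecay_pos (hδ : 0 < δ) (hδ1 : δ < 1) (hξ : 0 < ξ) (t : ℝ) : 0 < mlDecay δ ξ t := by
  rw [mlDecay_eq]
  exact mlKernel_one_pos hδ hδ1 hξ (le_max_right _ _)

theorem mlDecay_le_one (hδ : 0 < δ) (hδ1 : δ < 1) (hξ : 0 < ξ) (t : ℝ) : mlDecay δ ξ t ≤ 1 := by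
  rw [mlDecay_eq]
  exact mlKernel_one_le_one hδ hδ1 hξ (le_max_right _ _)

theorem continuous_mlDecay (hδ : 0 < δ) (hδ1 : δ < 1) : Continuous (mlDecay δ ξ) := by
  simp_rw [funext (mlDecay_eq (δ := δ) (ξ := ξ))]
  exact (continuous_mlKernel_one hδ hδ1).comp (continuous_id.max continuous_const)

/-- A delay costs at most a constant factor. -/
theorem mlDecay_sub_le (hδ : 0 < δ) (hδ1 : δ < 1) (hξ : 0 < ξ) {μ t : ℝ} (hμ : 0 < μ) (ht : 0 < t) :
    mlDecay δ ξ (t - μ) ≤ max (1 + ξ * Real.Gamma (1 - δ) * (2 * μ) ^ δ)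
      (1 / (ξ * μ ^ δ) + 2 ^ δ * Real.Gamma (1 - δ)) * mlDecay δ ξ t := by
  have hG : 0 < Real.Gamma (1 - δ) := Real.Gamma_pos_of_pos (sub_pos.2 hδ1)
  have hE := mlKernel_one_pos hδ hδ1 hξ ht.le
  have hlow := one_le_mlKernel_one_mul hδ hδ1 hξ ht.le
  rw [mlDecay_of_nonneg ht.le]
  have htδ : 0 < t ^ δ := Real.rpow_pos_of_pos ht _
  rcases le_total t (2 * μ) with h | h
  -- Early times: E(t - μ) ≤ 1, and the lower bound for E(t) with t ≤ 2μ gives the constant B.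
  · refine (mlDecay_le_one hδ hδ1 hξ _).trans (hlow.trans ?_)
    rw [mul_comm]
    refine mul_le_mul_of_nonneg_right (le_trans ?_ (le_max_left _ _)) hE.le
    have := Real.rpow_le_rpow ht.le h hδ.le
    gcongr
  -- Late times: t - μ ≥ t/2, so the upper bound of order t^(-δ) loses 2^δ; dividing by the lower
  -- bound gives F.
  · have htμ : 0 < t - μ := by linarith
    rw [mlDecay_of_nonneg htμ.le]
    have hμδ : 0 < μ ^ δ := Real.rpow_pos_of_pos hμ _
    -- Convexity of Γ between Γ(1) = Γ(2) = 1; this is why F contains no factor Γ(1+δ).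
    have hG1 : Real.Gamma (1 + δ) ≤ 1 := by
      have := Real.convexOn_Gamma.2 (show (1 : ℝ) ∈ Ioi 0 by simp) (show (2 : ℝ) ∈ Ioi 0 by simp)
        (sub_pos.2 hδ1).le hδ.le (by ring)
      simp only [smul_eq_mul, Real.Gamma_one, Real.Gamma_two] at this
      rw [show (1 - δ) * 1 + δ * 2 = 1 + δ by ring] at this
      linarith
    have h1 : mlKernel δ ξ 1 (t - μ) ≤ 2 ^ δ / (ξ * t ^ δ) := by
      refine (mlKernel_one_le_inv hδ hδ1 hξ htμ).trans ?_
      have h2 : (t - μ) ^ (-δ) ≤ (t / 2) ^ (-δ) :=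
        Real.rpow_le_rpow_of_nonpos (by linarith) (by linarith) (by linarith)
      have h3 : (t / 2) ^ (-δ) = 2 ^ δ / t ^ δ := by
        rw [Real.rpow_neg (by linarith), Real.div_rpow ht.le (by norm_num), inv_div]
      calc Real.Gamma (1 + δ) / ξ * (t - μ) ^ (-δ) ≤ 1 / ξ * (2 ^ δ / t ^ δ) := by
            rw [← h3]; gcongr
        _ = 2 ^ δ / (ξ * t ^ δ) := by field_simp
    refine h1.trans ?_
    have h4 : 2 ^ δ / (ξ * t ^ δ)
        ≤ 2 ^ δ / (ξ * t ^ δ) * (mlKernel δ ξ 1 t * (1 + ξ * Real.Gamma (1 - δ) * t ^ δ)) :=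
      le_mul_of_one_le_right (by positivity) hlow
    refine h4.trans ?_
    have e : 2 ^ δ / (ξ * t ^ δ) * (mlKernel δ ξ 1 t * (1 + ξ * Real.Gamma (1 - δ) * t ^ δ))
        = (2 ^ δ / (ξ * t ^ δ) + 2 ^ δ * Real.Gamma (1 - δ)) * mlKernel δ ξ 1 t := by
      field_simp
    rw [e]
    refine mul_le_mul_of_nonneg_right (le_trans ?_ (le_max_right _ _)) hE.le
    have h5 : (2 : ℝ) ^ δ * μ ^ δ ≤ t ^ δ := by
      rw [← Real.mul_rpow (by norm_num) hμ.le]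
      exact Real.rpow_le_rpow (by positivity) h hδ.le
    have h6 : 2 ^ δ / (ξ * t ^ δ) ≤ 1 / (ξ * μ ^ δ) := by
      rw [div_le_div_iff₀ (by positivity) (by positivity)]
      nlinarith [mul_le_mul_of_nonneg_left h5 hξ.le]
    linarith

end Decay

/-! ### Convolution of causal functions -/

/-- Functions on the half-line, extended by zero, that are integrable up to any time. -/
structure Causal (f : ℝ → ℝ) : Prop where
  integrableOn : ∀ T, IntegrableOn f (Iic T)
  zero : ∀ t ≤ 0, f t = 0

/-- Convolution on the real line. -/
noncomputable def conv (f g : ℝ → ℝ) : ℝ → ℝ :=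
  convolution f g (ContinuousLinearMap.mul ℝ ℝ) volume

theorem conv_apply (f g : ℝ → ℝ) (x : ℝ) : conv f g x = ∫ s, f s * g (x - s) := rfl

theorem conv_comm (f g : ℝ → ℝ) : conv f g = conv g f := by
  funext x
  rw [conv, convolution_eq_swap, conv_apply]
  exact integral_congr_ae (Eventually.of_forall fun s => mul_comm _ _)

theorem conv_congr {f f' g g' : ℝ → ℝ} (hf : f =ᵐ[volume] f') (hg : g =ᵐ[volume] g') :
    conv f g = conv f' g' :=
  convolution_congr _ hf hg

namespace Causal

variable {f g h : ℝ → ℝ}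

theorem aestronglyMeasurable (hf : Causal f) : AEStronglyMeasurable f volume := by
  have h := (aestronglyMeasurable_iUnion_iff (μ := volume) (f := f)
    (s := fun n : ℕ => Iic (n : ℝ))).2 fun n => (hf.integrableOn n).aestronglyMeasurable
  have e : (⋃ n : ℕ, Iic (n : ℝ)) = univ :=
    eq_univ_of_forall fun x => mem_iUnion.2 (exists_nat_ge x)
  rwa [e, Measure.restrict_univ] at h

theorem congr (hf : Causal f) (hfg : f =ᵐ[volume] g) (hg : ∀ t ≤ 0, g t = 0) : Causal g :=
  ⟨fun T => (hf.integrableOn T).congr_fun_ae (ae_restrict_of_ae hfg), hg⟩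

theorem add (hf : Causal f) (hg : Causal g) : Causal fun t => f t + g t :=
  ⟨fun T => (hf.integrableOn T).add (hg.integrableOn T), fun t ht => by
    simp [hf.zero t ht, hg.zero t ht]⟩

theorem const_mul (hf : Causal f) (c : ℝ) : Causal fun t => c * f t :=
  ⟨fun T => (hf.integrableOn T).const_mul c, fun t ht => by simp [hf.zero t ht]⟩

theorem norm (hf : Causal f) : Causal fun t => ‖f t‖ :=
  ⟨fun T => (hf.integrableOn T).norm, fun t ht => by simp [hf.zero t ht]⟩

/-- Convolution of causal functions up to time T sees only their values up to T. Truncation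
therefore reduces locally integrable functions to integrable ones on the line. -/
theorem indicator_mul_indicator (hf : Causal f) (hg : Causal g) {x T : ℝ} (hx : x ≤ T) (s : ℝ) :
    (Iic T).indicator f s * (Iic T).indicator g (x - s) = f s * g (x - s) := by
  by_cases h1 : s ≤ T
  · by_cases h2 : x - s ≤ T
    · simp [indicator, h1, h2]
    · rw [hf.zero s (by linarith)]
      simp [indicator, hf.zero s (by linarith)]
  · rw [hg.zero (x - s) (by linarith)]
    simp [indicator, h1]

theorem ae_convolutionExistsAt (hf : Causal f) (hg : Causal g) :
    ∀ᵐ x, ConvolutionExistsAt f g x (ContinuousLinearMap.mul ℝ ℝ) volume := by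
  have h : ∀ n : ℕ, ∀ᵐ x, ConvolutionExistsAt ((Iic (n : ℝ)).indicator f)
      ((Iic (n : ℝ)).indicator g) x (ContinuousLinearMap.mul ℝ ℝ) volume := fun n =>
    ((hf.integrableOn n).integrable_indicator measurableSet_Iic).ae_convolution_exists _
      ((hg.integrableOn n).integrable_indicator measurableSet_Iic)
  filter_upwards [ae_all_iff.2 h] with x hx
  obtain ⟨n, hn⟩ := exists_nat_ge x
  refine (hx n).congr (Eventually.of_forall fun s => ?_)
  exact hf.indicator_mul_indicator hg hn s

theorem conv (hf : Causal f) (hg : Causal g) : Causal (conv f g) := by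
  refine ⟨fun T => ?_, fun x hx => ?_⟩
  · have h := ((hf.integrableOn T).integrable_indicator measurableSet_Iic).integrable_convolution
      (ContinuousLinearMap.mul ℝ ℝ) ((hg.integrableOn T).integrable_indicator measurableSet_Iic)
    refine h.integrableOn.congr_fun (fun x hx => ?_) measurableSet_Iic
    exact integral_congr_ae (Eventually.of_forall fun s => hf.indicator_mul_indicator hg hx s)
  · rw [conv_apply]
    refine integral_eq_zero_of_ae (Eventually.of_forall fun s => ?_)
    rcases le_total s 0 with h | h
    · simp [hf.zero s h]
    · simp [hg.zero (x - s) (by linarith)]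

/-- Fubini applies wherever the convolution of the absolute values exists, which is almost
everywhere. Hence the identities below hold a.e. and are upgraded by continuity. -/
theorem conv_assoc (hf : Causal f) (hg : Causal g) (hh : Causal h) :
    _root_.conv (_root_.conv f g) h =ᵐ[volume] _root_.conv f (_root_.conv g h) := by
  filter_upwards [hf.norm.ae_convolutionExistsAt (hg.norm.conv hh.norm)] with x hx
  exact convolution_assoc _ _ _ _ (fun a b c => mul_assoc a b c) hf.aestronglyMeasurable
    hg.aestronglyMeasurable hh.aestronglyMeasurable (hf.ae_convolutionExistsAt hg)
    (hg.norm.ae_convolutionExistsAt hh.norm) hx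

theorem conv_add_mul (hf : Causal f) (hg : Causal g) (hh : Causal h) (c : ℝ) :
    _root_.conv f (fun t => g t + c * h t)
      =ᵐ[volume] fun t => _root_.conv f g t + c * _root_.conv f h t := by
  filter_upwards [hf.ae_convolutionExistsAt hg, hf.ae_convolutionExistsAt hh] with x h1 h2
  have i1 : Integrable fun s => f s * g (x - s) := h1
  have i2 : Integrable fun s => f s * h (x - s) := h2
  simp only [conv_apply]
  rw [← integral_const_mul, ← integral_add i1 (i2.const_mul c)]
  congr 1
  funext s
  ring

theorem conv_eq_intervalIntegral (hf : Causal f) (hg : Causal g) {x : ℝ} (hx : 0 ≤ x) :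
    _root_.conv f g x = ∫ s in (0 : ℝ)..x, f (x - s) * g s := by
  rw [conv_comm, conv_apply, intervalIntegral.integral_of_le hx,
    ← integral_indicator measurableSet_Ioc]
  congr 1
  funext s
  by_cases h : s ∈ Ioc 0 x
  · rw [indicator_of_mem h, mul_comm]
  · rw [indicator_of_notMem h]
    rcases le_or_gt s 0 with h0 | h0
    · rw [hg.zero s h0, zero_mul]
    · rw [hf.zero (x - s), mul_zero]
      by_contra hcon
      exact h ⟨h0, by linarith⟩

end Causal

theorem causal_indicator {f : ℝ → ℝ} (hf : ∀ T > 0, IntervalIntegrable f volume 0 T) :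
    Causal ((Ioi 0).indicator f) := by
  refine ⟨fun T => ?_, fun t ht => indicator_of_notMem (by simpa using ht) _⟩
  rw [IntegrableOn, integrable_indicator_iff measurableSet_Ioi, IntegrableOn,
    Measure.restrict_restrict measurableSet_Ioi, Ioi_inter_Iic]
  rcases le_or_gt T 0 with h | h
  · rw [Ioc_eq_empty (not_lt.2 h), Measure.restrict_empty]
    exact integrable_zero_measure
  · exact (intervalIntegrable_iff_integrableOn_Ioc_of_le h.le).1 (hf T h)

theorem conv_indicator {f g : ℝ → ℝ} (hf : ∀ T > 0, IntervalIntegrable f volume 0 T)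
    (hg : ∀ T > 0, IntervalIntegrable g volume 0 T) {x : ℝ} (hx : 0 ≤ x) :
    conv ((Ioi 0).indicator f) ((Ioi 0).indicator g) x = ∫ s in (0 : ℝ)..x, f (x - s) * g s := by
  rw [(causal_indicator hf).conv_eq_intervalIntegral (causal_indicator hg) hx,
    intervalIntegral.integral_of_le hx, intervalIntegral.integral_of_le hx,
    integral_Ioc_eq_integral_Ioo, integral_Ioc_eq_integral_Ioo]
  refine setIntegral_congr_fun measurableSet_Ioo fun s hs => ?_
  simp [indicator, hs.1, hs.2]

/-! ### Fractional and Mittag-Leffler kernels as causal functions -/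

theorem intervalIntegrable_fracKernel {α : ℝ} (hα : 0 < α) (a b : ℝ) :
    IntervalIntegrable (fracKernel α) volume a b :=
  (intervalIntegral.intervalIntegrable_rpow' (by linarith)).div_const _

theorem causal_fracKernel {α : ℝ} (hα : 0 < α) : Causal ((Ioi 0).indicator (fracKernel α)) :=
  causal_indicator fun _ _ => intervalIntegrable_fracKernel hα _ _

theorem causal_mlKernel {δ ξ ρ : ℝ} (hδ : 0 < δ) (hδ1 : δ < 1) (hρ : 0 < ρ) :
    Causal ((Ioi 0).indicator (mlKernel δ ξ ρ)) :=
  causal_indicator fun _ _ => intervalIntegrable_mlKernel hδ hδ1 hρ _ _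

theorem conv_fracKernel_mlKernel {δ ξ ρ β : ℝ} (hδ : 0 < δ) (hδ1 : δ < 1) (hρ : 0 < ρ)
    (hβ : 0 < β) :
    conv ((Ioi 0).indicator (fracKernel β)) ((Ioi 0).indicator (mlKernel δ ξ ρ))
      = (Ioi 0).indicator (mlKernel δ ξ (ρ + β)) := by
  funext x
  rcases le_or_gt x 0 with hx | hx
  · rw [((causal_fracKernel hβ).conv (causal_mlKernel hδ hδ1 hρ)).zero x hx,
      (causal_mlKernel hδ hδ1 (add_pos hρ hβ)).zero x hx]
  · rw [conv_indicator (fun _ _ => intervalIntegrable_fracKernel hβ _ _)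
      (fun _ _ => intervalIntegrable_mlKernel hδ hδ1 hρ _ _) hx.le,
      integral_fracKernel_mul_mlKernel hδ hδ1 hρ hβ hx, indicator_of_mem (mem_Ioi.2 hx)]

theorem indicator_mlKernel_eq {δ ξ ρ : ℝ} (hδ : 0 < δ) (hδ1 : δ < 1) (hρ : 0 < ρ) :
    (Ioi 0).indicator (mlKernel δ ξ ρ) = fun t => (Ioi 0).indicator (fracKernel ρ) t
      + -ξ * (Ioi 0).indicator (mlKernel δ ξ (ρ + δ)) t := by
  funext t
  by_cases ht : 0 < t
  · simp only [indicator, mem_Ioi, ht, if_true]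
    rw [mlKernel_eq_sub hδ hδ1 hρ ht]
    ring
  · simp [indicator, ht]

/-! ### Comparison of resolvent kernels for different dissipation parameters -/

/-- An almost everywhere inequality between functions continuous on an open set holds there. -/
theorem le_on_open_of_ae_le {f g : ℝ → ℝ} {U : Set ℝ} (hU : IsOpen U)
    (h : ∀ᵐ x, x ∈ U → f x ≤ g x) (hf : ContinuousOn f U) (hg : ContinuousOn g U) :
    ∀ x ∈ U, f x ≤ g x := by
  have h1 : (fun x => max (f x) (g x)) =ᵐ[volume.restrict U] g := by
    rw [EventuallyEq, ae_restrict_iff' hU.measurableSet]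
    filter_upwards [h] with x hx hxU using max_eq_right (hx hxU)
  intro x hx
  have := Measure.eqOn_open_of_ae_eq h1 hU (ContinuousOn.sup hf hg) hg hx
  exact (le_max_left _ _).trans_eq this

theorem continuousOn_mlKernel {δ ξ ρ : ℝ} (hδ : 0 < δ) (hδ1 : δ < 1) (hρ : 0 < ρ) :
    ContinuousOn (mlKernel δ ξ ρ) (Ioi 0) := fun _ ht =>
  (differentiableAt_mlKernel hδ hδ1 hρ ht).continuousAt.continuousWithinAt

/-- The resolvent kernel decreases in the dissipation parameter. -/
theorem mlKernel_le_of_le {δ ξ a t : ℝ} (hδ : 0 < δ) (hδ1 : δ < 1) (ha : ξ ≤ a) (ht : 0 < t) :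
    mlKernel δ a δ t ≤ mlKernel δ ξ δ t := by
  refine le_on_open_of_ae_le isOpen_Ioi ?_ (continuousOn_mlKernel hδ hδ1 hδ)
    (continuousOn_mlKernel hδ hδ1 hδ) t ht
  have hκ := causal_fracKernel hδ
  have hA := causal_mlKernel (ξ := a) hδ hδ1 hδ
  have hX := causal_mlKernel (ξ := ξ) hδ hδ1 hδ
  have cA := conv_fracKernel_mlKernel (ξ := a) hδ hδ1 hδ hδ
  have cX := conv_fracKernel_mlKernel (ξ := ξ) hδ hδ1 hδ hδ
  have eA := indicator_mlKernel_eq (ξ := a) hδ hδ1 hδ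
  have eX := indicator_mlKernel_eq (ξ := ξ) hδ hδ1 hδ
  rw [← cA] at eA
  rw [← cX] at eX
  have hnn : ∀ s, 0 ≤ conv ((Ioi 0).indicator (mlKernel δ a δ))
      ((Ioi 0).indicator (mlKernel δ ξ δ)) s := fun s =>
    integral_nonneg fun r => mul_nonneg
      (indicator_nonneg (fun _ h => (mlKernel_pos hδ hδ1 h).le) _)
      (indicator_nonneg (fun _ h => (mlKernel_pos hδ hδ1 h).le) _)
  have eA0 := congrFun eA
  have eX0 := congrFun eX
  have indA : ∀ s ∈ Ioi (0 : ℝ), (Ioi 0).indicator (mlKernel δ a δ) s = mlKernel δ a δ s :=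
    fun s hs => indicator_of_mem hs _
  have indX : ∀ s ∈ Ioi (0 : ℝ), (Ioi 0).indicator (mlKernel δ ξ δ) s = mlKernel δ ξ δ s :=
    fun s hs => indicator_of_mem hs _
  set κ := (Ioi 0).indicator (fracKernel δ)
  set A := (Ioi 0).indicator (mlKernel δ a δ)
  set X := (Ioi 0).indicator (mlKernel δ ξ δ)
  -- Resolvent identity: expanding either factor of A * X by A = κ - a κ * A and X = κ - ξ κ * X,
  -- and comparing, gives X - A = (a - ξ) A * X, which is nonnegative.
  have w1 : conv A X =ᵐ[volume] fun t => conv A κ t + -ξ * conv A (conv κ X) t := by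
    conv_lhs => rw [eX]
    exact hA.conv_add_mul hκ (hκ.conv hX) _
  have w2 : conv X A =ᵐ[volume] fun t => conv X κ t + -a * conv X (conv κ A) t := by
    conv_lhs => rw [eA]
    exact hX.conv_add_mul hκ (hκ.conv hA) _
  have w3 := hX.conv_assoc hκ hA
  filter_upwards [w1, w2, w3] with s h1 h2 h3 hs
  have p1 : conv A (conv κ X) = conv (conv X κ) A := by rw [conv_comm A, conv_comm κ]
  rw [p1, conv_comm A κ] at h1
  rw [conv_comm X A, ← h3, conv_comm X κ] at h2
  rw [conv_comm X κ] at h1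
  have := hnn s
  rw [← indA s hs, ← indX s hs, eA0 s, eX0 s]
  have e : conv κ A s = conv A X s + ξ * conv (conv κ X) A s := by linarith
  have e' : conv κ X s = conv A X s + a * conv (conv κ X) A s := by linarith
  rw [e, e']
  nlinarith [mul_nonneg (sub_nonneg.2 ha) this]

/-- Convolve the comparison of the resolvent kernels with the nonnegative kernel of order 1 - δ. -/
theorem mlKernel_one_le_of_le {δ ξ a t : ℝ} (hδ : 0 < δ) (hδ1 : δ < 1) (ha : ξ ≤ a)
    (ht : 0 ≤ t) : mlKernel δ a 1 t ≤ mlKernel δ ξ 1 t := by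
  rcases ht.eq_or_lt with rfl | ht
  · rw [mlKernel_one_zero hδ hδ1, mlKernel_one_zero hδ hδ1]
  have hδ' : 0 < 1 - δ := sub_pos.2 hδ1
  rw [← integral_fracKernel_one_sub_mul_mlKernel hδ hδ1 ht,
    ← integral_fracKernel_one_sub_mul_mlKernel hδ hδ1 ht]
  refine intervalIntegral.integral_mono_on_of_le_Ioo ht.le
    (intervalIntegrable_fracKernel_mul_mlKernel hδ hδ1 hδ hδ' ht)
    (intervalIntegrable_fracKernel_mul_mlKernel hδ hδ1 hδ hδ' ht) fun s hs => ?_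
  exact mul_le_mul_of_nonneg_left (mlKernel_le_of_le hδ hδ1 ha hs.1)
    (fracKernel_nonneg hδ' (by linarith [hs.2]))

/-! ### Variation of constants for the linear Caputo equation -/

theorem caputoDeriv_eq_conv {δ : ℝ} (hδ1 : δ < 1) {z : ℝ → ℝ}
    (hz : ∀ T > 0, IntervalIntegrable (deriv z) volume 0 T) {t : ℝ} (ht : 0 < t) :
    caputoDeriv δ z t
      = conv ((Ioi 0).indicator (fracKernel (1 - δ))) ((Ioi 0).indicator (deriv z)) t := by
  rw [conv_indicator (fun _ _ => intervalIntegrable_fracKernel (sub_pos.2 hδ1) _ _) hz ht.le,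
    caputoDeriv, ← intervalIntegral.integral_const_mul]
  congr 1
  funext w
  rw [fracKernel, show 1 - δ - 1 = -δ by ring]
  ring

/-- Solutions of `D^δ z = -a z + G` are given by the variation of constants formula. -/
theorem caputo_variation_of_constants {δ a : ℝ} (hδ : 0 < δ) (hδ1 : δ < 1) {z G : ℝ → ℝ}
    (hz : ∀ T > 0, AbsolutelyContinuousOnInterval z 0 T)
    (heq : ∀ᵐ t : ℝ, 0 < t → caputoDeriv δ z t = -a * z t + G t) :
    ∀ᵐ t : ℝ, 0 < t → z t = z 0 * mlKernel δ a 1 t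
      + ∫ s in (0 : ℝ)..t, mlKernel δ a δ (t - s) * G s := by
  have hδ' : 0 < 1 - δ := sub_pos.2 hδ1
  have hdz : ∀ T > 0, IntervalIntegrable (deriv z) volume 0 T := fun T hT =>
    (hz T hT).intervalIntegrable_deriv
  have hzi : ∀ T > 0, IntervalIntegrable z volume 0 T := fun T hT =>
    (hz T hT).continuousOn.intervalIntegrable
  have hD := causal_indicator hdz
  have hZ := causal_indicator hzi
  have hκ := causal_fracKernel hδ'
  have hone := causal_fracKernel one_pos
  have he := causal_mlKernel (ξ := a) hδ hδ1 hδ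
  have hftc : conv ((Ioi 0).indicator (fracKernel 1)) ((Ioi 0).indicator (deriv z))
      = fun t => (Ioi 0).indicator z t + -z 0 * (Ioi 0).indicator (fracKernel 1) t := by
    funext t
    rcases le_or_gt t 0 with ht | ht
    · rw [(hone.conv hD).zero t ht, hZ.zero t ht, hone.zero t ht]; simp
    · rw [conv_indicator (fun _ _ => intervalIntegrable_fracKernel one_pos _ _) hdz ht.le]
      simp only [fracKernel_one, one_mul, (hz t ht).integral_deriv_eq_sub, indicator, mem_Ioi, ht,
        if_true]
      ring
  have hG : (Ioi 0).indicator G =ᵐ[volume] fun t =>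
      conv ((Ioi 0).indicator (fracKernel (1 - δ))) ((Ioi 0).indicator (deriv z)) t
        + a * (Ioi 0).indicator z t := by
    filter_upwards [heq] with t h
    rcases le_or_gt t 0 with ht | ht
    · rw [(hκ.conv hD).zero t ht, hZ.zero t ht, indicator_of_notMem (by simpa using ht)]; simp
    · rw [← caputoDeriv_eq_conv hδ1 hdz ht, h ht, indicator_of_mem (mem_Ioi.2 ht),
        indicator_of_mem (mem_Ioi.2 ht)]
      ring
  -- Local integrability of G is read off the equation itself, which expresses G a.e. through z and
  -- its Caputo derivative.
  have hGc : Causal ((Ioi 0).indicator G) :=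
    ((hκ.conv hD).add (hZ.const_mul a)).congr hG.symm fun t ht =>
      indicator_of_notMem (by simpa using ht) _
  have hGi : ∀ T > 0, IntervalIntegrable G volume 0 T := fun T hT => by
    have h := (hGc.integrableOn T).mono_set (Ioc_subset_Iic_self (a := 0))
    refine (intervalIntegrable_iff_integrableOn_Ioc_of_le hT.le).2
      (h.congr_fun (fun s hs => indicator_of_mem (mem_Ioi.2 hs.1) _) measurableSet_Ioc)
  have hval : ∀ t > 0, conv ((Ioi 0).indicator (mlKernel δ a δ)) ((Ioi 0).indicator G) t
      = ∫ s in (0 : ℝ)..t, mlKernel δ a δ (t - s) * G s := fun t ht =>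
    conv_indicator (fun _ _ => intervalIntegrable_mlKernel hδ hδ1 hδ _ _) hGi ht.le
  have hE : conv ((Ioi 0).indicator (fracKernel (1 - δ))) ((Ioi 0).indicator (mlKernel δ a δ))
      = fun t => (Ioi 0).indicator (fracKernel 1) t
        + -a * conv ((Ioi 0).indicator (fracKernel 1)) ((Ioi 0).indicator (mlKernel δ a δ)) t := by
    rw [conv_fracKernel_mlKernel hδ hδ1 hδ hδ', conv_fracKernel_mlKernel hδ hδ1 hδ one_pos,
      add_sub_cancel, indicator_mlKernel_eq hδ hδ1 one_pos, add_comm δ 1]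
  have hE1 : ∀ t > 0, conv ((Ioi 0).indicator (fracKernel (1 - δ)))
      ((Ioi 0).indicator (mlKernel δ a δ)) t = mlKernel δ a 1 t := fun t ht => by
    rw [conv_fracKernel_mlKernel hδ hδ1 hδ hδ', add_sub_cancel, indicator_of_mem (mem_Ioi.2 ht)]
  have hZz : ∀ t > 0, (Ioi 0).indicator z t = z t := fun t ht => indicator_of_mem (mem_Ioi.2 ht) _
  set D := (Ioi 0).indicator (deriv z)
  set Z := (Ioi 0).indicator z
  set κ := (Ioi 0).indicator (fracKernel (1 - δ))
  set o := (Ioi 0).indicator (fracKernel 1)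
  set e := (Ioi 0).indicator (mlKernel δ a δ)
  -- Convolve the equation with e. Since e * κ = o - a o * e and o * D = Z - z(0) o, the terms a e *
  -- Z cancel and e * G = Z - z(0) (o - a o * e), where the bracket is the Mittag-Leffler function
  -- with parameter a.
  have s1 : conv e ((Ioi 0).indicator G) =ᵐ[volume]
      fun t => conv e (conv κ D) t + a * conv e Z t := by
    rw [conv_congr (ae_eq_refl e) hG]
    exact he.conv_add_mul (hκ.conv hD) hZ a
  have s2 := he.conv_assoc hκ hD
  have s3 : conv D (conv κ e) =ᵐ[volume] fun t => conv D o t + -a * conv D (conv o e) t := by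
    rw [hE]
    exact hD.conv_add_mul hone (hone.conv he) _
  have s4 := he.conv_assoc hone hD
  have s5 : conv e (conv o D) =ᵐ[volume] fun t => conv e Z t + -z 0 * conv e o t := by
    rw [hftc]
    exact he.conv_add_mul hZ hone _
  have hE0 := congrFun hE
  filter_upwards [s1, s2, s3, s4, s5] with t h1 h2 h3 h4 h5 ht
  rw [← hval t ht, h1, ← h2, conv_comm _ D, conv_comm e κ, h3, conv_comm D (conv o e),
    conv_comm o e, h4, h5, conv_comm D o, hftc, ← hE1 t ht, hE0 t, ← hZz t ht, conv_comm o e]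
  ring

/-! ### Distributed delays -/

/-- A continuous function which is negative up to time zero and has no first zero afterwards is
negative. -/
theorem neg_of_no_first_zero {m : ℝ → ℝ} (hm : Continuous m) (h0 : ∀ s ≤ 0, m s < 0)
    (hstep : ∀ T > 0, (∀ s < T, m s ≤ 0) → m T < 0) (t : ℝ) : m t < 0 := by
  by_contra hcon
  have ht : 0 < t := by
    by_contra h
    exact hcon (h0 t (not_lt.1 h))
  obtain ⟨T, ⟨hT, hmT⟩, hleast⟩ :=
    (isCompact_Icc.inter_right (isClosed_Ici.preimage hm)).exists_isLeast
      (s := Icc 0 t ∩ m ⁻¹' Ici 0) ⟨t, ⟨ht.le, le_rfl⟩, not_lt.1 hcon⟩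
  have hT0 : 0 < T := hT.1.lt_of_ne fun h => absurd (h0 T h.symm.le) (not_lt.2 hmT)
  refine absurd (hstep T hT0 fun s hs => ?_) (not_lt.2 hmT)
  by_contra hms
  rcases le_total s 0 with h | h
  · exact hms (h0 s h).le
  · exact absurd (hleast ⟨⟨h, hs.le.trans hT.2⟩, (not_le.1 hms).le⟩) (not_le.2 hs)

section Delay

variable {D K : ℝ → ℝ}

theorem integrableOn_mul_decay (hD : Continuous D) (hD0 : ∀ s, 0 ≤ D s) (hD1 : ∀ s, D s ≤ 1)
    (hK : IntegrableOn K (Ioi 0)) (t : ℝ) : IntegrableOn (fun w => K w * D (t - w)) (Ioi 0) :=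
  Integrable.mul_bdd (c := 1) hK
    (hD.comp (continuous_const.sub continuous_id)).aestronglyMeasurable
    (Eventually.of_forall fun w => by
      rw [Real.norm_of_nonneg (hD0 _)]; exact hD1 _)

/-- Dominated convergence with majorant |K|. Continuity makes the product with the weakly singular
kernel e integrable. -/
theorem continuous_integral_mul_decay (hD : Continuous D) (hD0 : ∀ s, 0 ≤ D s)
    (hD1 : ∀ s, D s ≤ 1) (hK : IntegrableOn K (Ioi 0)) :
    Continuous fun t => ∫ w in Ioi (0 : ℝ), K w * D (t - w) := by
  refine continuous_of_dominated (bound := fun w => ‖K w‖)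
    (fun t => (integrableOn_mul_decay hD hD0 hD1 hK t).aestronglyMeasurable)
    (fun t => Eventually.of_forall fun w => ?_) hK.norm
    (Eventually.of_forall fun w => continuous_const.mul
      (hD.comp (continuous_id.sub continuous_const)))
  rw [norm_mul, Real.norm_of_nonneg (hD0 _)]
  exact mul_le_of_le_one_right (norm_nonneg _) (hD1 _)

theorem setIntegral_Iic_eq_Ioi (f : ℝ → ℝ) (t : ℝ) :
    ∫ l in Iic t, f l = ∫ w in Ioi (0 : ℝ), f (t - w) := by
  rw [← integral_Ici_eq_integral_Ioi, ← integral_indicator measurableSet_Iic,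
    ← integral_indicator measurableSet_Ici, ← integral_sub_left_eq_self _ volume t]
  congr 1
  funext w
  by_cases h : 0 ≤ w
  · rw [indicator_of_mem (show w ∈ Ici 0 from h), indicator_of_mem (show t - w ∈ Iic t by simpa)]
  · rw [indicator_of_notMem (show w ∉ Ici 0 from h),
      indicator_of_notMem (show t - w ∉ Iic t by simpa using h)]

variable {k h g y : ℝ → ℝ} {L R ys t : ℝ}

/-- The delay integral runs over w > 0, so bounds strictly before t suffice; this is what a
first-contact argument provides. -/
theorem abs_delay_sub_le (hk : IsDelayKernel k) (hD : Continuous D) (hD0 : ∀ s, 0 ≤ D s)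
    (hD1 : ∀ s, D s ≤ 1) (hg : ∀ u v, |g u - g v| ≤ L * |u - v|) (hL : 0 ≤ L)
    (hint : IntegrableOn (fun w => k w * g (y (t - w))) (Ioi 0))
    (hy : ∀ s < t, |y s - ys| ≤ R * D s) :
    |(∫ w in Ioi (0 : ℝ), k w * g (y (t - w))) - kernelMass k * g ys|
      ≤ L * R * ∫ w in Ioi (0 : ℝ), k w * D (t - w) := by
  rw [kernelMass, ← integral_mul_const, ← integral_sub hint (hk.integrableOn.mul_const _),
    ← integral_const_mul, ← Real.norm_eq_abs]
  refine norm_integral_le_of_norm_le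
    ((integrableOn_mul_decay hD hD0 hD1 hk.integrableOn t).const_mul _) ?_
  filter_upwards [ae_restrict_mem measurableSet_Ioi] with w hw
  have hk0 := hk.nonneg w (le_of_lt hw)
  rw [← mul_sub, norm_mul, Real.norm_of_nonneg hk0, Real.norm_eq_abs]
  have h1 := hg (y (t - w)) ys
  have h2 := mul_le_mul_of_nonneg_left (hy (t - w) (sub_lt_self t hw)) hL
  nlinarith [mul_le_mul_of_nonneg_left (h1.trans h2) hk0]

theorem integral_kernel_mul_decay_le (hk : IsDelayKernel k) (hD : Continuous D)
    (hD0 : ∀ s, 0 ≤ D s) (hD1 : ∀ s, D s ≤ 1) (hK : IntegrableOn K (Ioi 0))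
    (hkK : ∀ w > 0, k w ≤ K w) (t : ℝ) :
    ∫ w in Ioi (0 : ℝ), k w * D (t - w) ≤ ∫ w in Ioi (0 : ℝ), K w * D (t - w) :=
  setIntegral_mono_on (integrableOn_mul_decay hD hD0 hD1 hk.integrableOn t)
    (integrableOn_mul_decay hD hD0 hD1 hK t) measurableSet_Ioi fun w hw =>
    mul_le_mul_of_nonneg_right (hkK w hw) (hD0 _)

theorem integral_kernel_mul_decay_le_mass (hk : IsDelayKernel k) (hD : Continuous D)
    (hD0 : ∀ s, 0 ≤ D s) (hD1 : ∀ s, D s ≤ 1) (t : ℝ) :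
    ∫ w in Ioi (0 : ℝ), k w * D (t - w) ≤ kernelMass k :=
  setIntegral_mono_on (integrableOn_mul_decay hD hD0 hD1 hk.integrableOn t) hk.integrableOn
    measurableSet_Ioi fun w hw => mul_le_of_le_one_right (hk.nonneg w (le_of_lt hw)) (hD1 _)

theorem kernelMass_nonneg (hk : IsDelayKernel k) : 0 ≤ kernelMass k :=
  setIntegral_nonneg measurableSet_Ioi fun w hw => hk.nonneg w (le_of_lt hw)

/-- Deviation of a second order delayed interaction from its equilibrium value. -/
theorem abs_secondOrder_sub_le {g₁ g₂ y₁ y₂ : ℝ → ℝ} {L₁ L₂ y₁s y₂s : ℝ}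
    (hk : IsDelayKernel k) (hh : IsDelayKernel h) (hD : Continuous D) (hD0 : ∀ s, 0 ≤ D s)
    (hD1 : ∀ s, D s ≤ 1) (hK : IntegrableOn K (Ioi 0)) (hkK : ∀ w > 0, k w ≤ K w)
    (hhK : ∀ w > 0, h w ≤ K w) (hg₁ : ∀ u v, |g₁ u - g₁ v| ≤ L₁ * |u - v|)
    (hg₂ : ∀ u v, |g₂ u - g₂ v| ≤ L₂ * |u - v|) (hL₁ : 0 ≤ L₁) (hL₂ : 0 ≤ L₂) (hR : 0 ≤ R)
    (hint₁ : IntegrableOn (fun w => k w * g₁ (y₁ (t - w))) (Ioi 0))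
    (hint₂ : IntegrableOn (fun w => h w * g₂ (y₂ (t - w))) (Ioi 0))
    (hy₁ : ∀ s < t, |y₁ s - y₁s| ≤ R * D s) (hy₂ : ∀ s < t, |y₂ s - y₂s| ≤ R * D s) :
    |(∫ w in Ioi (0 : ℝ), k w * g₁ (y₁ (t - w))) * (∫ w in Ioi (0 : ℝ), h w * g₂ (y₂ (t - w)))
        - kernelMass k * g₁ y₁s * (kernelMass h * g₂ y₂s)|
      ≤ (L₁ * kernelMass h * |g₂ y₂s| + L₂ * kernelMass k * |g₁ y₁s|
          + L₁ * L₂ * kernelMass h * R) * R * ∫ w in Ioi (0 : ℝ), K w * D (t - w) := by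
  have b1 := abs_delay_sub_le hk hD hD0 hD1 hg₁ hL₁ hint₁ hy₁
  have b2 := abs_delay_sub_le hh hD hD0 hD1 hg₂ hL₂ hint₂ hy₂
  have k1 := integral_kernel_mul_decay_le hk hD hD0 hD1 hK hkK t
  have k2 := integral_kernel_mul_decay_le hh hD hD0 hD1 hK hhK t
  have m2 := integral_kernel_mul_decay_le_mass hh hD hD0 hD1 t
  have mk := kernelMass_nonneg hk
  have mh := kernelMass_nonneg hh
  set P := ∫ w in Ioi (0 : ℝ), k w * g₁ (y₁ (t - w))
  set Q := ∫ w in Ioi (0 : ℝ), h w * g₂ (y₂ (t - w))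
  set Φ := ∫ w in Ioi (0 : ℝ), K w * D (t - w)
  have p1 : |P - kernelMass k * g₁ y₁s| ≤ L₁ * R * Φ :=
    b1.trans (mul_le_mul_of_nonneg_left k1 (mul_nonneg hL₁ hR))
  have q1 : |Q - kernelMass h * g₂ y₂s| ≤ L₂ * R * Φ :=
    b2.trans (mul_le_mul_of_nonneg_left k2 (mul_nonneg hL₂ hR))
  -- In the quadratic remainder one deviation keeps the factor Φ and the other is bounded by the
  -- kernel mass, so all three terms are multiples of Φ.
  have q2 : |Q - kernelMass h * g₂ y₂s| ≤ L₂ * R * kernelMass h :=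
    b2.trans (mul_le_mul_of_nonneg_left m2 (mul_nonneg hL₂ hR))
  set p := kernelMass k * g₁ y₁s with hp
  set q := kernelMass h * g₂ y₂s with hq
  have ep : |p| = kernelMass k * |g₁ y₁s| := by rw [hp, abs_mul, abs_of_nonneg mk]
  have eq : |q| = kernelMass h * |g₂ y₂s| := by rw [hq, abs_mul, abs_of_nonneg mh]
  have e : P * Q - p * q = (P - p) * q + p * (Q - q) + (P - p) * (Q - q) := by ring
  have t1 : |(P - p) * q| ≤ L₁ * R * Φ * |q| := by
    rw [abs_mul]; exact mul_le_mul_of_nonneg_right p1 (abs_nonneg _)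
  have t2 : |p * (Q - q)| ≤ |p| * (L₂ * R * Φ) := by
    rw [abs_mul]; exact mul_le_mul_of_nonneg_left q1 (abs_nonneg _)
  have t3 : |(P - p) * (Q - q)| ≤ L₁ * R * Φ * (L₂ * R * kernelMass h) := by
    rw [abs_mul]; exact mul_le_mul p1 q2 (abs_nonneg _) ((abs_nonneg _).trans p1)
  rw [e]
  refine (abs_add_three _ _ _).trans ((add_le_add (add_le_add t1 t2) t3).trans_eq ?_)
  rw [ep, eq]
  ring

end Delay

/-! ### The scalar neutral equation -/

theorem mlKernel_zero {δ a : ℝ} (hδ1 : δ < 1) : mlKernel δ a δ 0 = 0 := by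
  rw [mlKernel, Real.zero_rpow (sub_neg.2 hδ1).ne, zero_mul]

theorem mlKernel_nonneg {δ a t : ℝ} (hδ : 0 < δ) (hδ1 : δ < 1) (ht : 0 ≤ t) :
    0 ≤ mlKernel δ a δ t := by
  rcases ht.eq_or_lt with rfl | ht
  · rw [mlKernel_zero hδ1]
  · exact (mlKernel_pos hδ hδ1 ht).le

theorem intervalIntegrable_mlKernel_mul {δ ξ : ℝ} (hδ : 0 < δ) (hδ1 : δ < 1) {f : ℝ → ℝ}
    (hf : Continuous f) (t : ℝ) :
    IntervalIntegrable (fun s => mlKernel δ ξ δ (t - s) * f s) volume 0 t := by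
  have h := (intervalIntegrable_mlKernel (ξ := ξ) hδ hδ1 hδ 0 t).comp_sub_left t
  rw [sub_zero, sub_self] at h
  exact h.symm.mul_continuousOn hf.continuousOn

/-- A solution of `D^δ z = -a z + G` with forcing `|G| ≤ α E_δ(-ξ t ^ δ) + β Φ` decays like the
Mittag-Leffler function, if `Φ` has this property after convolution with the resolvent kernel. -/
theorem abs_le_of_caputo {δ ξ a α β Ω T : ℝ} (hδ : 0 < δ) (hδ1 : δ < 1) (hξ : 0 < ξ) (ha : ξ ≤ a)
    (hα : 0 ≤ α) (hβ : 0 ≤ β) {z G Φ : ℝ → ℝ} (hΦ : Continuous Φ) (hzc : Continuous z)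
    (hz : ∀ T > 0, AbsolutelyContinuousOnInterval z 0 T)
    (heq : ∀ᵐ t : ℝ, 0 < t → caputoDeriv δ z t = -a * z t + G t)
    (hT : 0 < T) (hG : ∀ s ∈ Ioo 0 T, |G s| ≤ α * mlKernel δ ξ 1 s + β * Φ s)
    (hcond : ∀ t > 0, ∫ s in (0 : ℝ)..t, mlKernel δ ξ δ (t - s) * Φ s ≤ Ω * mlKernel δ ξ 1 t) :
    |z T| ≤ (|z 0| + α * (Real.Gamma (1 + δ) * Real.Gamma (1 - δ) / ξ) + β * Ω)
      * mlKernel δ ξ 1 T := by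
  set M := |z 0| + α * (Real.Gamma (1 + δ) * Real.Gamma (1 - δ) / ξ) + β * Ω with hM
  have hEc := continuous_mlKernel_one (ξ := ξ) hδ hδ1
  have hae : ∀ᵐ t : ℝ, t ∈ Ioo 0 T → |z t| ≤ M * mlKernel δ ξ 1 t := by
    filter_upwards [caputo_variation_of_constants hδ hδ1 hz heq] with t hrep ht
    have ht0 : 0 < t := ht.1
    rw [hrep ht0]
    have hI1 := (intervalIntegrable_mlKernel_mul (ξ := ξ) hδ hδ1 hEc t).const_mul α
    have hI2 := (intervalIntegrable_mlKernel_mul (ξ := ξ) hδ hδ1 hΦ t).const_mul β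
    have h1 : |∫ s in (0 : ℝ)..t, mlKernel δ a δ (t - s) * G s|
        ≤ ∫ s in (0 : ℝ)..t, (α * (mlKernel δ ξ δ (t - s) * mlKernel δ ξ 1 s)
          + β * (mlKernel δ ξ δ (t - s) * Φ s)) := by
      rw [← Real.norm_eq_abs]
      refine intervalIntegral.norm_integral_le_of_norm_le ht0.le
        (Eventually.of_forall fun s hs => ?_) (hI1.add hI2)
      have hts : 0 ≤ t - s := sub_nonneg.2 hs.2
      have e1 := mlKernel_nonneg (a := a) hδ hδ1 hts
      have e2 : mlKernel δ a δ (t - s) ≤ mlKernel δ ξ δ (t - s) := by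
        rcases hts.eq_or_lt with h | h
        · rw [← h, mlKernel_zero hδ1, mlKernel_zero hδ1]
        · exact mlKernel_le_of_le hδ hδ1 ha h
      rw [norm_mul, Real.norm_of_nonneg e1, Real.norm_eq_abs]
      refine (mul_le_mul e2 (hG s ⟨hs.1, hs.2.trans_lt ht.2⟩) (abs_nonneg _)
        (e1.trans e2)).trans_eq ?_
      ring
    rw [intervalIntegral.integral_add hI1 hI2, intervalIntegral.integral_const_mul,
      intervalIntegral.integral_const_mul] at h1
    have h2 := mul_le_mul_of_nonneg_left (integral_mlKernel_mul_mlKernel_one_le hδ hδ1 hξ ht0) hα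
    have h3 := mul_le_mul_of_nonneg_left (hcond t ht0) hβ
    have h4 : |z 0 * mlKernel δ a 1 t| ≤ |z 0| * mlKernel δ ξ 1 t := by
      rw [abs_mul, abs_of_pos (mlKernel_one_pos hδ hδ1 (hξ.trans_le ha) ht0.le)]
      exact mul_le_mul_of_nonneg_left (mlKernel_one_le_of_le hδ hδ1 ha ht0.le) (abs_nonneg _)
    have h5 := abs_add_le (z 0 * mlKernel δ a 1 t)
      (∫ s in (0 : ℝ)..t, mlKernel δ a δ (t - s) * G s)
    rw [hM, add_mul, add_mul, mul_assoc α, mul_assoc β]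
    linarith
  -- The representation holds only a.e.; continuity of z gives the bound on all of (0, T), and a
  -- left limit carries it to T, where nothing was assumed.
  have hall := le_on_open_of_ae_le isOpen_Ioo hae hzc.abs.continuousOn
    (continuous_const.mul hEc).continuousOn
  refine le_of_tendsto_of_tendsto (b := 𝓝[<] T)
    ((hzc.abs.tendsto T).mono_left nhdsWithin_le_nhds)
    (((continuous_const.mul hEc).tendsto T).mono_left nhdsWithin_le_nhds) ?_
  filter_upwards [Ioo_mem_nhdsLT hT] with s hs using hall s hs

/-! ### Exchange of the layers and a priori estimates for one layer -/

namespace BAMNetwork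

variable {n₁ n₂ : ℕ} (N : BAMNetwork n₁ n₂)

/-- The network with the roles of the two layers exchanged. -/
def swap : BAMNetwork n₂ n₁ where
  δ := N.δ
  μ := N.μ
  c := N.cbar
  cbar := N.c
  a := N.abar
  abar := N.a
  d := N.dbar
  dbar := N.d
  k := N.kbar
  h := N.hbar
  kbar := N.k
  hbar := N.h
  g := N.gbar
  gbar := N.g
  I := N.J
  J := N.I
  δ_pos := N.δ_pos
  δ_lt_one := N.δ_lt_one
  μ_pos := N.μ_pos
  c_pos := N.cbar_pos
  cbar_pos := N.c_pos
  a_pos := N.abar_pos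
  abar_pos := N.a_pos

variable {N}

/-- The equations for y are by definition the equations for x in the exchanged network, so estimates
are proved for x only. -/
theorem IsSolution.swap {φ : Fin n₁ → ℝ → ℝ} {ψ : Fin n₂ → ℝ → ℝ} {x : Fin n₁ → ℝ → ℝ}
    {y : Fin n₂ → ℝ → ℝ} (h : N.IsSolution φ ψ x y) : N.swap.IsSolution ψ φ y x where
  continuous_x := h.continuous_y
  continuous_y := h.continuous_x
  history_x := h.history_y
  history_y := h.history_x
  integrable_k := h.integrable_kbar
  integrable_h := h.integrable_hbar
  integrable_kbar := h.integrable_k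
  integrable_hbar := h.integrable_h
  absCont_x := h.absCont_y
  absCont_y := h.absCont_x
  eq_x := h.eq_y
  eq_y := h.eq_x

theorem IsEquilibrium.swap {xs : Fin n₁ → ℝ} {ys : Fin n₂ → ℝ} (h : N.IsEquilibrium xs ys) :
    N.swap.IsEquilibrium ys xs :=
  ⟨h.eq_y, h.eq_x⟩

theorem KernelAssumption.swap (h : N.KernelAssumption) : N.swap.KernelAssumption :=
  ⟨h.kernel_kbar, h.kernel_hbar, h.kernel_k, h.kernel_h⟩

theorem LipschitzActivations.swap {L : Fin n₂ → ℝ} {M : Fin n₁ → ℝ}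
    (h : N.LipschitzActivations L M) : N.swap.LipschitzActivations M L :=
  ⟨h.lip_gbar, h.lip_g⟩

theorem LipschitzActivations.nonneg {L : Fin n₂ → ℝ} {M : Fin n₁ → ℝ}
    (h : N.LipschitzActivations L M) (q : Fin n₂) : 0 ≤ L q := by
  simpa using (abs_nonneg _).trans (h.lip_g q 1 0)

variable (N) in
theorem theta_swap (M : Fin n₁ → ℝ) (xs : Fin n₁ → ℝ) : N.swap.theta M xs = N.thetaBar M xs := by
  change (∑ q, ∑ p, ∑ r, |N.dbar p q r| *
    (M p * kernelMass (N.hbar p q r) * |N.gbar r (xs r)|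
      + M r * kernelMass (N.kbar p q r) * |N.gbar p (xs p)|)) = _
  rw [thetaBar, Finset.sum_comm]
  exact Finset.sum_congr rfl fun p _ => Finset.sum_comm

variable (N) in
/-- Coefficient of the quadratic part of the interaction terms. -/
noncomputable def quadConst (L : Fin n₂ → ℝ) : ℝ :=
  ∑ p, ∑ q, ∑ s, |N.d q p s| * (L q * L s * kernelMass (N.h q p s))

theorem quadConst_nonneg {L : Fin n₂ → ℝ} (hL : ∀ q, 0 ≤ L q) (hA1 : N.KernelAssumption) :
    0 ≤ N.quadConst L :=
  Finset.sum_nonneg fun p _ => Finset.sum_nonneg fun q _ => Finset.sum_nonneg fun s _ =>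
    mul_nonneg (abs_nonneg _) (mul_nonneg (mul_nonneg (hL q) (hL s))
      (kernelMass_nonneg (hA1.kernel_h q p s)))

section Estimate

variable {L : Fin n₂ → ℝ} {M : Fin n₁ → ℝ} {xs : Fin n₁ → ℝ} {ys : Fin n₂ → ℝ}
  {φ : Fin n₁ → ℝ → ℝ} {ψ : Fin n₂ → ℝ → ℝ} {x : Fin n₁ → ℝ → ℝ} {y : Fin n₂ → ℝ → ℝ}
  {D K : ℝ → ℝ} {R : ℝ}

/-- Deviation of the interaction terms of one neuron from their equilibrium value. -/
theorem abs_rhsX_add_le (hEq : N.IsEquilibrium xs ys) (hA1 : N.KernelAssumption)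
    (hA3 : N.LipschitzActivations L M) (hsol : N.IsSolution φ ψ x y) (hD : Continuous D)
    (hD0 : ∀ s, 0 ≤ D s) (hD1 : ∀ s, D s ≤ 1) (hK : IntegrableOn K (Ioi 0))
    (hkK : ∀ q p s, ∀ w > 0, N.k q p s w ≤ K w) (hhK : ∀ q p s, ∀ w > 0, N.h q p s w ≤ K w)
    (hR : 0 ≤ R) (p : Fin n₁) {t : ℝ} (ht : 0 < t)
    (hy : ∀ s < t, ∑ q, |y q s - ys q| ≤ R * D s) :
    |N.rhsX x y p t + N.a p * (x p t - xs p)|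
      ≤ ((∑ q, ∑ s, |N.d q p s| * (L q * kernelMass (N.h q p s) * |N.g s (ys s)|
            + L s * kernelMass (N.k q p s) * |N.g q (ys q)|))
          + (∑ q, ∑ s, |N.d q p s| * (L q * L s * kernelMass (N.h q p s))) * R) * R
        * ∫ w in Ioi (0 : ℝ), K w * D (t - w) := by
  have hyq : ∀ q, ∀ s < t, |y q s - ys q| ≤ R * D s := fun q s hs =>
    (Finset.single_le_sum (f := fun q => |y q s - ys q|) (fun _ _ => abs_nonneg _)
      (Finset.mem_univ q)).trans (hy s hs)
  set Φ := ∫ w in Ioi (0 : ℝ), K w * D (t - w)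
  -- Subtracting the equilibrium equation removes the input and leaves only deviations of products.
  have e : N.rhsX x y p t + N.a p * (x p t - xs p) = ∑ q, ∑ s, N.d q p s *
      ((∫ w in Ioi (0 : ℝ), N.k q p s w * N.g q (y q (t - w)))
        * (∫ w in Ioi (0 : ℝ), N.h q p s w * N.g s (y s (t - w)))
        - kernelMass (N.k q p s) * N.g q (ys q) * (kernelMass (N.h q p s) * N.g s (ys s))) := by
    have h := hEq.eq_x p
    simp only [mul_sub, Finset.sum_sub_distrib, rhsX]
    simp only [← mul_assoc]
    linarith
  rw [e]
  have e2 : ((∑ q, ∑ s, |N.d q p s| * (L q * kernelMass (N.h q p s) * |N.g s (ys s)|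
            + L s * kernelMass (N.k q p s) * |N.g q (ys q)|))
          + (∑ q, ∑ s, |N.d q p s| * (L q * L s * kernelMass (N.h q p s))) * R) * R * Φ
      = ∑ q, ∑ s, |N.d q p s| * ((L q * kernelMass (N.h q p s) * |N.g s (ys s)|
            + L s * kernelMass (N.k q p s) * |N.g q (ys q)|
            + L q * L s * kernelMass (N.h q p s) * R) * R * Φ) := by
    simp only [Finset.sum_mul, ← Finset.sum_add_distrib]
    exact Finset.sum_congr rfl fun q _ => Finset.sum_congr rfl fun s _ => by ring
  rw [e2]
  refine (Finset.abs_sum_le_sum_abs _ _).trans (Finset.sum_le_sum fun q _ => ?_)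
  refine (Finset.abs_sum_le_sum_abs _ _).trans (Finset.sum_le_sum fun s _ => ?_)
  rw [abs_mul]
  exact mul_le_mul_of_nonneg_left (abs_secondOrder_sub_le (hA1.kernel_k q p s)
    (hA1.kernel_h q p s) hD hD0 hD1 hK (hkK q p s) (hhK q p s) (hA3.lip_g q) (hA3.lip_g s)
    (hA3.nonneg q) (hA3.nonneg s) hR (hsol.integrable_k q p s t ht)
    (hsol.integrable_h q p s t ht) (hyq q) (hyq s)) (abs_nonneg _)

/-- A priori bounds up to time `T` improve at time `T`. -/
theorem sum_abs_sub_le (hEq : N.IsEquilibrium xs ys) (hA1 : N.KernelAssumption)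
    (hA3 : N.LipschitzActivations L M) (hsol : N.IsSolution φ ψ x y) {ξ B Ω V T : ℝ} (hξ : 0 < ξ)
    (hξa : ∀ p, ξ ≤ N.a p) (hB : 0 ≤ B)
    (hdelay : ∀ t > 0, mlDecay N.δ ξ (t - N.μ) ≤ B * mlDecay N.δ ξ t)
    (hK : IntegrableOn K (Ioi 0)) (hkK : ∀ q p s, ∀ w > 0, N.k q p s w ≤ K w)
    (hhK : ∀ q p s, ∀ w > 0, N.h q p s w ≤ K w)
    (hcond : ∀ t > 0, ∫ s in (0 : ℝ)..t, mlKernel N.δ ξ N.δ (t - s) *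
      (∫ w in Ioi (0 : ℝ), K w * mlDecay N.δ ξ (s - w)) ≤ Ω * mlKernel N.δ ξ 1 t)
    (hc : N.c ≤ 1) (hR : 0 ≤ R) (hT : 0 < T)
    (hx : ∀ s < T, ∑ p, |x p s - xs p| ≤ R * mlDecay N.δ ξ s)
    (hy : ∀ s < T, ∑ q, |y q s - ys q| ≤ R * mlDecay N.δ ξ s)
    (hV : ∀ s ≤ 0, ∑ p, |x p s - xs p| ≤ V) :
    ∑ p, |x p T - xs p| ≤ (2 * V + N.c * B * (1 + (∑ p, N.a p) *
        (Real.Gamma (1 + N.δ) * Real.Gamma (1 - N.δ) / ξ)) * R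
      + Ω * (N.theta L ys + N.quadConst L * R) * R) * mlDecay N.δ ξ T := by
  have hδ := N.δ_pos
  have hδ1 := N.δ_lt_one
  have hD := continuous_mlDecay (ξ := ξ) hδ hδ1
  have hD0 : ∀ s, 0 ≤ mlDecay N.δ ξ s := fun s => (mlDecay_pos hδ hδ1 hξ s).le
  have hD1 := mlDecay_le_one hδ hδ1 hξ
  have hL := hA3.nonneg
  have hc0 := N.c_pos.le
  set Γ₂ := Real.Gamma (1 + N.δ) * Real.Gamma (1 - N.δ) / ξ with hΓ₂
  have hxp : ∀ p, ∀ s < T, |x p s - xs p| ≤ R * mlDecay N.δ ξ s := fun p s hs =>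
    (Finset.single_le_sum (f := fun p => |x p s - xs p|) (fun _ _ => abs_nonneg _)
      (Finset.mem_univ p)).trans (hx s hs)
  set E := mlDecay N.δ ξ T with hE
  set θ : Fin n₁ → ℝ := fun p => ∑ q, ∑ s, |N.d q p s| *
    (L q * kernelMass (N.h q p s) * |N.g s (ys s)|
      + L s * kernelMass (N.k q p s) * |N.g q (ys q)|) with hθ
  set κ : Fin n₁ → ℝ := fun p =>
    ∑ q, ∑ s, |N.d q p s| * (L q * L s * kernelMass (N.h q p s)) with hκ
  -- The neutral combination of the deviations: the constant (1 - c) x_p* does not affect the Caputo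
  -- derivative, and z solves the scalar equation with an additional delayed forcing.
  set z : Fin n₁ → ℝ → ℝ :=
    fun p t => x p t - N.c * x p (t - N.μ) - (1 - N.c) * xs p with hz
  have hzabs : ∀ p t, z p t = (x p t - xs p) - N.c * (x p (t - N.μ) - xs p) := fun p t => by
    simp only [hz]; ring
  have hzT : ∀ p, |z p T| ≤
      (|z p 0| + N.c * B * R * N.a p * Γ₂ + (θ p + κ p * R) * R * Ω) * E := by
    intro p
    have hθ0 : 0 ≤ θ p := Finset.sum_nonneg fun q _ => Finset.sum_nonneg fun s _ =>
      mul_nonneg (abs_nonneg _) (add_nonneg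
        (mul_nonneg (mul_nonneg (hL q) (kernelMass_nonneg (hA1.kernel_h q p s))) (abs_nonneg _))
        (mul_nonneg (mul_nonneg (hL s) (kernelMass_nonneg (hA1.kernel_k q p s))) (abs_nonneg _)))
    have hκ0 : 0 ≤ κ p := Finset.sum_nonneg fun q _ => Finset.sum_nonneg fun s _ =>
      mul_nonneg (abs_nonneg _) (mul_nonneg (mul_nonneg (hL q) (hL s))
        (kernelMass_nonneg (hA1.kernel_h q p s)))
    have ha := N.a_pos p
    have hder : ∀ t, caputoDeriv N.δ (z p) t
        = caputoDeriv N.δ (fun t => x p t - N.c * x p (t - N.μ)) t := fun t => by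
      simp only [caputoDeriv, hz, deriv_sub_const_fun]
    rw [hE, mlDecay_of_nonneg hT.le]
    refine abs_le_of_caputo (a := N.a p) (G := fun t => N.rhsX x y p t + N.a p * z p t)
      (Φ := fun s => ∫ w in Ioi (0 : ℝ), K w * mlDecay N.δ ξ (s - w)) hδ hδ1 hξ (hξa p)
      (by positivity) (by positivity) (continuous_integral_mul_decay hD hD0 hD1 hK) ?_ ?_ ?_ hT
      ?_ hcond
    · have := hsol.continuous_x p
      simp only [hz]
      fun_prop
    · exact fun S hS => (hsol.absCont_x p S hS).sub
        (LipschitzWith.const ((1 - N.c) * xs p)).lipschitzOnWith.absolutelyContinuousOnInterval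
    · filter_upwards [hsol.eq_x p] with t h ht
      rw [hder, h ht]
      ring
    · intro s hs
      have h1 := abs_rhsX_add_le hEq hA1 hA3 hsol hD hD0 hD1 hK hkK hhK hR p hs.1
        (fun r hr => hy r (hr.trans hs.2))
      have h2 : |N.a p * N.c * (x p (s - N.μ) - xs p)|
          ≤ N.c * B * R * N.a p * mlDecay N.δ ξ s := by
        rw [abs_mul, abs_of_nonneg (by positivity)]
        have h3 := (hxp p (s - N.μ) (by linarith [hs.2, N.μ_pos])).trans
          (mul_le_mul_of_nonneg_left (hdelay s hs.1) hR)
        refine (mul_le_mul_of_nonneg_left h3 (by positivity)).trans_eq ?_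
        ring
      have e : N.rhsX x y p s + N.a p * z p s = N.rhsX x y p s + N.a p * (x p s - xs p)
          - N.a p * N.c * (x p (s - N.μ) - xs p) := by rw [hzabs]; ring
      simp only [e]
      rw [← mlDecay_of_nonneg hs.1.le]
      exact (abs_sub _ _).trans ((add_le_add h1 h2).trans_eq (add_comm _ _))
  have hsum : ∀ p, |x p T - xs p| ≤ (|x p 0 - xs p| + N.c * |x p (0 - N.μ) - xs p|) * E
      + (N.c * B * R * N.a p * Γ₂ + (θ p + κ p * R) * R * Ω) * E
      + N.c * |x p (T - N.μ) - xs p| := by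
    intro p
    have h1 : |z p 0| ≤ |x p 0 - xs p| + N.c * |x p (0 - N.μ) - xs p| := by
      rw [hzabs]
      refine (abs_sub _ _).trans_eq ?_
      rw [abs_mul, abs_of_nonneg hc0]
    -- Recovering x from z costs a second delayed term; it is the summand 1 beside the Gamma factor
    -- in the final bound.
    have h2 : |x p T - xs p| ≤ |z p T| + N.c * |x p (T - N.μ) - xs p| := by
      have e : x p T - xs p = z p T + N.c * (x p (T - N.μ) - xs p) := by rw [hzabs]; ring
      rw [e]
      refine (abs_add_le _ _).trans_eq ?_
      rw [abs_mul, abs_of_nonneg hc0]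
    have h3 := mul_le_mul_of_nonneg_right h1 (hD0 T)
    have h4 := hzT p
    rw [← hE] at h3
    linarith
  have htot := Finset.sum_le_sum fun p (_ : p ∈ Finset.univ) => hsum p
  have eθ : ∑ p, θ p = N.theta L ys := rfl
  have eκ : ∑ p, κ p = N.quadConst L := rfl
  simp only [Finset.sum_add_distrib, ← Finset.sum_mul, ← Finset.mul_sum, eθ, eκ] at htot
  have v0 := hV 0 le_rfl
  have v1 := hV (0 - N.μ) (by linarith [N.μ_pos])
  -- z(0) involves the history at 0 and at -μ; with c ≤ 1 this accounts for 2 V.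
  have v1' : 0 ≤ ∑ p, |x p (0 - N.μ) - xs p| := Finset.sum_nonneg fun _ _ => abs_nonneg _
  have v2 : N.c * ∑ p, |x p (0 - N.μ) - xs p| ≤ V := by nlinarith
  have v3 := mul_le_mul_of_nonneg_right (add_le_add v0 v2) (hD0 T)
  have d1 := mul_le_mul_of_nonneg_left
    ((hx (T - N.μ) (by linarith [N.μ_pos])).trans (mul_le_mul_of_nonneg_left (hdelay T hT) hR)) hc0
  rw [← hE] at v3 d1
  linarith

end Estimate

end BAMNetwork

/-! ### The maximal kernel and the constants of the network -/

theorem IntegrableOn.iSup_of_fintype {ι : Type*} [Fintype ι] [Nonempty ι] {f : ι → ℝ → ℝ}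
    {S : Set ℝ} (hf : ∀ i, IntegrableOn (f i) S) : IntegrableOn (fun t => ⨆ i, f i t) S := by
  refine Integrable.mono' (integrable_finsetSum Finset.univ fun i _ => (hf i).norm)
    (AEMeasurable.iSup fun i => (hf i).aemeasurable).aestronglyMeasurable
    (Eventually.of_forall fun t => ?_)
  obtain ⟨i, hi⟩ := exists_eq_ciSup_of_finite (f := fun i => f i t)
  rw [← hi]
  exact Finset.single_le_sum (f := fun i => ‖f i t‖) (fun _ _ => norm_nonneg _) (Finset.mem_univ i)

namespace BAMNetwork

variable {n₁ n₂ : ℕ} {N : BAMNetwork n₁ n₂}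

theorem integrableOn_kStar [NeZero n₁] [NeZero n₂] (hA1 : N.KernelAssumption) :
    IntegrableOn N.kStar (Ioi 0) := by
  have h1 := IntegrableOn.iSup_of_fintype (f := fun i : Fin n₂ × Fin n₁ × Fin n₂ =>
    N.k i.1 i.2.1 i.2.2) fun i => (hA1.kernel_k _ _ _).integrableOn
  have h2 := IntegrableOn.iSup_of_fintype (f := fun i : Fin n₂ × Fin n₁ × Fin n₂ =>
    N.h i.1 i.2.1 i.2.2) fun i => (hA1.kernel_h _ _ _).integrableOn
  have h3 := IntegrableOn.iSup_of_fintype (f := fun i : Fin n₁ × Fin n₂ × Fin n₁ =>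
    N.kbar i.1 i.2.1 i.2.2) fun i => (hA1.kernel_kbar _ _ _).integrableOn
  have h4 := IntegrableOn.iSup_of_fintype (f := fun i : Fin n₁ × Fin n₂ × Fin n₁ =>
    N.hbar i.1 i.2.1 i.2.2) fun i => (hA1.kernel_hbar _ _ _).integrableOn
  exact (Integrable.sup h1 h2).sup (Integrable.sup h3 h4)

theorem k_le_kStar (q : Fin n₂) (p : Fin n₁) (s : Fin n₂) (w : ℝ) : N.k q p s w ≤ N.kStar w :=
  (le_ciSup (f := fun i : Fin n₂ × Fin n₁ × Fin n₂ => N.k i.1 i.2.1 i.2.2 w)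
    (finite_range _).bddAbove (q, p, s)).trans ((le_max_left _ _).trans (le_max_left _ _))

theorem h_le_kStar (q : Fin n₂) (p : Fin n₁) (s : Fin n₂) (w : ℝ) : N.h q p s w ≤ N.kStar w :=
  (le_ciSup (f := fun i : Fin n₂ × Fin n₁ × Fin n₂ => N.h i.1 i.2.1 i.2.2 w)
    (finite_range _).bddAbove (q, p, s)).trans ((le_max_right _ _).trans (le_max_left _ _))

theorem kbar_le_kStar (p : Fin n₁) (q : Fin n₂) (r : Fin n₁) (w : ℝ) :
    N.kbar p q r w ≤ N.kStar w :=
  (le_ciSup (f := fun i : Fin n₁ × Fin n₂ × Fin n₁ => N.kbar i.1 i.2.1 i.2.2 w)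
    (finite_range _).bddAbove (p, q, r)).trans ((le_max_left _ _).trans (le_max_right _ _))

theorem hbar_le_kStar (p : Fin n₁) (q : Fin n₂) (r : Fin n₁) (w : ℝ) :
    N.hbar p q r w ≤ N.kStar w :=
  (le_ciSup (f := fun i : Fin n₁ × Fin n₂ × Fin n₁ => N.hbar i.1 i.2.1 i.2.2 w)
    (finite_range _).bddAbove (p, q, r)).trans ((le_max_right _ _).trans (le_max_right _ _))

theorem aMin_pos [NeZero n₁] : 0 < N.aMin := by
  obtain ⟨p, hp⟩ := exists_eq_ciInf_of_finite (f := N.a)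
  rw [aMin, ← hp]
  exact N.a_pos p

theorem abarMin_pos [NeZero n₂] : 0 < N.abarMin := aMin_pos (N := N.swap)

theorem ξ_le_a (p : Fin n₁) : N.ξ ≤ N.a p :=
  (min_le_left _ _).trans (ciInf_le (finite_range _).bddBelow p)

theorem ξ_le_abar (q : Fin n₂) : N.ξ ≤ N.abar q :=
  (min_le_right _ _).trans (ciInf_le (finite_range _).bddBelow q)

theorem kernel_condition_mlKernel {L : Fin n₂ → ℝ} {M : Fin n₁ → ℝ} {xs : Fin n₁ → ℝ}
    {ys : Fin n₂ → ℝ} {Ω : ℝ} (hA5 : N.SmallnessAssumption L M xs ys Ω) {t : ℝ} (ht : 0 < t) :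
    ∫ s in (0 : ℝ)..t, mlKernel N.δ N.ξ N.δ (t - s) *
      (∫ w in Ioi (0 : ℝ), N.kStar w * mlDecay N.δ N.ξ (s - w)) ≤ Ω * mlKernel N.δ N.ξ 1 t := by
  have h := hA5.kernel_condition t ht
  simp only [setIntegral_Iic_eq_Ioi, sub_sub_cancel, mul_comm (mlDecay _ _ _)] at h
  rw [mlKernel_one]
  exact h

/-- The improved a priori bound is strictly better for small amplitudes. -/
theorem improved_bound_lt {c B S Γ₂ cs U Ω θ π Q Q' R V D : ℝ} (hc : 0 ≤ c) (hcs : c ≤ cs)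
    (hB : 0 ≤ B) (hU : S * Γ₂ ≤ U) (hS : 0 ≤ S * Γ₂) (hsmall : cs * B * (1 + U) < 1 / 2)
    (hΩ : 0 < Ω) (hθ : θ ≤ π) (hπ : Ω * π < 1 / 4) (hQ : Q ≤ Q') (hQR : Ω * Q' * R ≤ 1 / 16)
    (hR : 0 < R) (hV : 16 * V ≤ R) (hD : 0 < D) :
    (2 * V + c * B * (1 + S * Γ₂) * R + Ω * (θ + Q * R) * R) * D < R * D := by
  refine mul_lt_mul_of_pos_right ?_ hD
  have h1 : c * B * (1 + S * Γ₂) ≤ cs * B * (1 + U) := by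
    have : 0 ≤ cs := hc.trans hcs
    gcongr
  -- Budget in units of R: history 1/8 since R ≥ 16 V, neutral terms less than 1/2, linear
  -- interactions 1/4, quadratic interactions 1/16.
  have h2 : Ω * (θ + Q * R) ≤ 1 / 4 + 1 / 16 := by
    have h3 := mul_le_mul_of_nonneg_left hθ hΩ.le
    have h4 := mul_le_mul_of_nonneg_right (mul_le_mul_of_nonneg_left hQ hΩ.le) hR.le
    linarith
  have h5 : c * B * (1 + S * Γ₂) * R < 1 / 2 * R :=
    mul_lt_mul_of_pos_right (h1.trans_lt hsmall) hR
  have h6 := mul_le_mul_of_nonneg_right h2 hR.le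
  linarith

end BAMNetwork

/-! ### The continuity argument for both layers -/

theorem theorem2 {n₁ n₂ : ℕ} [NeZero n₁] [NeZero n₂] (N : BAMNetwork n₁ n₂)
    (L : Fin n₂ → ℝ) (M : Fin n₁ → ℝ) (xs : Fin n₁ → ℝ) (ys : Fin n₂ → ℝ) (Ω : ℝ)
    (hEq : N.IsEquilibrium xs ys)
    (hA1 : N.KernelAssumption) (hA3 : N.LipschitzActivations L M)
    (hA5 : N.SmallnessAssumption L M xs ys Ω) :
    0 < N.ξ ∧ ∃ C > 0, ∃ ε > 0,
      ∀ (φ : Fin n₁ → ℝ → ℝ) (ψ : Fin n₂ → ℝ → ℝ) (x : Fin n₁ → ℝ → ℝ) (y : Fin n₂ → ℝ → ℝ)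
        (u₀ v₀ V₀ : ℝ), N.IsSolution φ ψ x y → 0 < u₀ → 0 < v₀ → V₀ = max u₀ v₀ → V₀ < ε →
        (∀ w ≤ 0, ∑ p, |φ p w - xs p| ≤ u₀ * mlDecay N.δ N.aMin (w + N.μ)) →
        (∀ w ≤ 0, ∑ q, |ψ q w - ys q| ≤ v₀ * mlDecay N.δ N.abarMin (w + N.μ)) →
        ∀ t > 0,
          ∑ p, |x p t - xs p| ≤ C * V₀ * mittagLeffler N.δ (-N.ξ * t ^ N.δ) ∧
          ∑ q, |y q t - ys q| ≤ C * V₀ * mittagLeffler N.δ (-N.ξ * t ^ N.δ) := by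
  have hδ := N.δ_pos
  have hδ1 := N.δ_lt_one
  have hξ : 0 < N.ξ := lt_min BAMNetwork.aMin_pos BAMNetwork.abarMin_pos
  have hQ1 := BAMNetwork.quadConst_nonneg hA3.nonneg hA1
  have hQ2 := BAMNetwork.quadConst_nonneg hA3.swap.nonneg hA1.swap
  have hΩ := hA5.Ω_pos
  -- The sum dominates the quadratic constants of both layers, so one threshold serves both.
  set Q := N.quadConst L + N.swap.quadConst M with hQ
  have hQ0 : 0 ≤ Q := add_nonneg hQ1 hQ2
  -- ε is chosen so that R = 16 V₀ satisfies Ω Q R ≤ 1/16; the added 1 keeps the denominator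
  -- positive when Q = 0.
  refine ⟨hξ, 16, by norm_num, 1 / (256 * (Ω * Q + 1)), by positivity, ?_⟩
  intro φ ψ x y u₀ v₀ V₀ hsol hu₀ hv₀ hV₀ hV₀ε hφ hψ t ht
  have huV : u₀ ≤ V₀ := hV₀ ▸ le_max_left _ _
  have hvV : v₀ ≤ V₀ := hV₀ ▸ le_max_right _ _
  have hVpos : 0 < V₀ := hu₀.trans_le huV
  set R := 16 * V₀ with hR
  have hRpos : 0 < R := by positivity
  have hQR : Ω * Q * R ≤ 1 / 16 := by
    rw [lt_div_iff₀ (by positivity)] at hV₀ε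
    rw [hR]
    linarith
  -- The history bound is used only through the value 1 bounding the Mittag-Leffler factor.
  have hx0 : ∀ s ≤ 0, ∑ p, |x p s - xs p| ≤ V₀ := fun s hs => by
    simp only [hsol.history_x _ s hs]
    exact ((hφ s hs).trans (mul_le_of_le_one_right hu₀.le
      (mlDecay_le_one hδ hδ1 BAMNetwork.aMin_pos _))).trans huV
  have hy0 : ∀ s ≤ 0, ∑ q, |y q s - ys q| ≤ V₀ := fun s hs => by
    simp only [hsol.history_y _ s hs]
    exact ((hψ s hs).trans (mul_le_of_le_one_right hv₀.le
      (mlDecay_le_one hδ hδ1 BAMNetwork.abarMin_pos _))).trans hvV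
  have hGG : 0 < Real.Gamma (1 + N.δ) * Real.Gamma (1 - N.δ) / N.ξ :=
    div_pos (mul_pos (Real.Gamma_pos_of_pos (by linarith))
      (Real.Gamma_pos_of_pos (by linarith))) hξ
  have hSa : 0 ≤ ∑ p, N.a p := Finset.sum_nonneg fun p _ => (N.a_pos p).le
  have hSb : 0 ≤ ∑ q, N.abar q := Finset.sum_nonneg fun q _ => (N.abar_pos q).le
  have hB : 0 < N.bStar := by
    refine lt_of_lt_of_le ?_ (le_max_left _ _)
    have := Real.Gamma_pos_of_pos (show 0 < 1 - N.δ by linarith)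
    have := Real.rpow_pos_of_pos (show 0 < 2 * N.μ by linarith [N.μ_pos]) N.δ
    rw [BAMNetwork.bigB]
    positivity
  have hU : 0 ≤ N.bigU := mul_nonneg (hSa.trans (le_max_left _ _)) hGG.le
  have hdelay : ∀ t > 0, mlDecay N.δ N.ξ (t - N.μ) ≤ N.bStar * mlDecay N.δ N.ξ t :=
    fun t ht => mlDecay_sub_le hδ hδ1 hξ N.μ_pos ht
  have hsmall : N.cStar * N.bStar * (1 + N.bigU) < 1 / 2 := by
    have h := hA5.c_small.trans_le (min_le_right _ _)
    rw [lt_div_iff₀ (by positivity)] at h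
    linarith
  have hc1 : N.cStar < 1 := hA5.c_small.trans_le (min_le_left _ _)
  have hK := BAMNetwork.integrableOn_kStar hA1
  have hD := continuous_mlDecay (ξ := N.ξ) hδ hδ1
  have hDpos := mlDecay_pos (ξ := N.ξ) hδ hδ1 hξ
  -- A single function for both layers, since improving either bound needs the bounds on x and on y
  -- before T.
  set m : ℝ → ℝ := fun s => max (∑ p, |x p s - xs p| - R * mlDecay N.δ N.ξ s)
    (∑ q, |y q s - ys q| - R * mlDecay N.δ N.ξ s) with hm
  have hmc : Continuous m := by
    have := hsol.continuous_x
    have := hsol.continuous_y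
    fun_prop
  have hneg := neg_of_no_first_zero hmc (fun s hs => ?_) (fun T hT hpre => ?_) t
  · have h1 := (le_max_left _ _).trans_lt hneg
    have h2 := (le_max_right _ _).trans_lt hneg
    rw [mlDecay_of_nonneg ht.le, mlKernel_one] at h1 h2
    exact ⟨by linarith, by linarith⟩
  · rw [hm]
    simp only [mlDecay_of_nonpos hδ hδ1 hs, max_lt_iff]
    exact ⟨by linarith [hx0 s hs], by linarith [hy0 s hs]⟩
  · have hx : ∀ s < T, ∑ p, |x p s - xs p| ≤ R * mlDecay N.δ N.ξ s := fun s hs =>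
      sub_nonpos.1 ((le_max_left _ _).trans (hpre s hs))
    have hy : ∀ s < T, ∑ q, |y q s - ys q| ≤ R * mlDecay N.δ N.ξ s := fun s hs =>
      sub_nonpos.1 ((le_max_right _ _).trans (hpre s hs))
    have b1 := BAMNetwork.sum_abs_sub_le hEq hA1 hA3 hsol hξ BAMNetwork.ξ_le_a hB.le hdelay hK
      (fun q p s w _ => BAMNetwork.k_le_kStar q p s w)
      (fun q p s w _ => BAMNetwork.h_le_kStar q p s w)
      (fun t ht => BAMNetwork.kernel_condition_mlKernel hA5 ht)
      ((le_max_left _ _).trans hc1.le) hRpos.le hT hx hy hx0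
    have b2 := BAMNetwork.sum_abs_sub_le hEq.swap hA1.swap hA3.swap hsol.swap hξ
      BAMNetwork.ξ_le_abar hB.le hdelay hK
      (fun q p s w _ => BAMNetwork.kbar_le_kStar q p s w)
      (fun q p s w _ => BAMNetwork.hbar_le_kStar q p s w)
      (fun t ht => BAMNetwork.kernel_condition_mlKernel hA5 ht)
      ((le_max_right _ _).trans hc1.le) hRpos.le hT hy hx hy0
    have c1 := BAMNetwork.improved_bound_lt (V := V₀) N.c_pos.le (le_max_left _ _ : N.c ≤ N.cStar)
      hB.le (mul_le_mul_of_nonneg_right (le_max_left _ _) hGG.le : _ ≤ N.bigU)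
      (mul_nonneg hSa hGG.le) hsmall hΩ (le_max_left _ _ : N.theta L ys ≤ N.piConst L M xs ys)
      hA5.Ω_small (le_add_of_nonneg_right hQ2) hQR hRpos le_rfl (hDpos T)
    have c2 := BAMNetwork.improved_bound_lt (V := V₀) N.cbar_pos.le
      (le_max_right _ _ : N.cbar ≤ N.cStar) hB.le
      (mul_le_mul_of_nonneg_right (le_max_right _ _) hGG.le : _ ≤ N.bigU)
      (mul_nonneg hSb hGG.le) hsmall hΩ
      ((N.theta_swap M xs).trans_le (le_max_right _ _) : _ ≤ N.piConst L M xs ys)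
      hA5.Ω_small (le_add_of_nonneg_left hQ1) hQR hRpos le_rfl (hDpos T)
    exact max_lt (sub_neg.2 (b1.trans_lt c1)) (sub_neg.2 (b2.trans_lt c2))
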